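/- A *Heyting algebra of width at most $2$* is one whose poset $A_*$ of prime filters (ordered by inclusion) has no principal upset ${\uparrow}x$ containing an antichain of $3$ elements; it has *incomparability degree at most $2$* if no principal upset ${\uparrow}x$ of $A_*$ contains a point that is incomparable with $3$ elements of ${\uparrow}x$. Let $\mathsf{W}_2$ and $\mathsf{ID}_2$ be the corresponding classes of Heyting algebras. For a Heyting algebra $A$, $A_*$ is also given the topology with subbasis the sets $\{F : a\in F\}$ and their complements ($a\in A$). For a variety $\mathsf{K}$ of Heyting algebras, $\mathsf{K}_*$ is the class of ordered topological spaces isomorphic to $A_*$ for some $A\in\mathsf{K}$, and $\mathbb{V}(A)$ is the variety generated by $A$. An *Esakia space* is a compact Hausdorff space with a basis of clopen sets, with a partial order such that every ${\uparrow}x$ is closed and ${\downarrow}U$ is clopen for every clopen $U$; for an Esakia space $X$, $X^*$ is the Heyting algebra of its clopen upsets, with $U\to V=X\smallsetminus{\downarrow}(U\smallsetminus V)$. Let $D_2^\infty$ be the Esakia space consisting of two-element antichains $L_0,L_1,L_2,\dots$ and one further point $\top$, where every element of $L_n$ lies below every element of $L_m$ whenever $n<m$, and $\top$ is the greatest element;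 a set $U$ is open iff $\top\notin U$ or $U$ contains all but finitely many of the $L_n$. Let $RN$ be the Rieger–Nishimura lattice, i.e. the lattice of downsets of the poset $\{w_n : n\in\mathbb{N}\}$ in which $w_m<w_n$ iff $m+2\le n$. A variety $\mathsf{K}$ has the *ES property* if every epimorphism of the category of members of $\mathsf{K}$ and their homomorphisms is surjective. 1. If $\mathsf{K}$ is a variety of Heyting algebras with $\mathsf{K}\subseteq\mathsf{ID}_2\cap\mathsf{W}_2$ and $D_2^\infty\in\mathsf{K}_*$, then $\mathsf{K}$ lacks the ES property. 2. $\mathsf{ID}_2\cap\mathsf{W}_2$ is a variety, and every variety $\mathsf{K}$ with $\mathbb{V}((D_2^\infty)^*)\subseteq\mathsf{K}\subseteq\mathsf{ID}_2\cap\mathsf{W}_2$ lacks the ES property. 3. In particular, $\mathbb{V}((D_2^\infty)^*)\subseteq\mathbb{V}(RN)\subseteq\mathsf{ID}_2\cap\mathsf{W}_2$, and $\mathbb{V}(RN)$ lacks the ES property. -/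

import Mathlib

universe u v

namespace HeytingES

/-! ### Equational classes (varieties) of Heyting algebras -/

/-- Terms in the language of Heyting algebras over countably many variables. -/
inductive HTerm : Type where
  | var : ℕ → HTerm
  | bot : HTerm
  | top : HTerm
  | inf : HTerm → HTerm → HTerm
  | sup : HTerm → HTerm → HTerm
  | imp : HTerm → HTerm → HTerm

/-- The value of a term in a Heyting algebra under an assignment of the variables. -/
def HTerm.eval {A : Type u} [HeytingAlgebra A] (v : ℕ → A) : HTerm → A
  | HTerm.var n => v n
  | HTerm.bot => ⊥
  | HTerm.top => ⊤
  | HTerm.inf s t => s.eval v ⊓ t.eval v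
  | HTerm.sup s t => s.eval v ⊔ t.eval v
  | HTerm.imp s t => s.eval v ⇨ t.eval v

/-- The Heyting algebra `A` satisfies the equation `e.1 ≈ e.2`. -/
def Satisfies (A : Type u) [HeytingAlgebra A] (e : HTerm × HTerm) : Prop :=
  ∀ v : ℕ → A, e.1.eval v = e.2.eval v

/-- Classes of Heyting algebras (with universe `Type u`). -/
abbrev HAClass : Type (u + 1) := (A : Type u) → [HeytingAlgebra A] → Prop

/-- Inclusion of classes of Heyting algebras. -/
def IsSubclass (K L : HAClass.{u}) : Prop :=
  ∀ (A : Type u) [HeytingAlgebra A], K A → L A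

/-- A variety of Heyting algebras: the class of all Heyting algebras that satisfy a given set of
equations. -/
def IsVariety (K : HAClass.{u}) : Prop :=
  ∃ E : Set (HTerm × HTerm), ∀ (A : Type u) [HeytingAlgebra A],
    K A ↔ ∀ e ∈ E, Satisfies A e

/-- The variety generated by the Heyting algebra `B`: the class of all Heyting algebras that
satisfy every equation valid in `B`. -/
def GeneratedVariety (B : Type v) [HeytingAlgebra B] : HAClass.{u} :=
  fun A _ => ∀ e : HTerm × HTerm, Satisfies B e → Satisfies A e

theorem generatedVariety_isVariety (B : Type v) [HeytingAlgebra B] :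
    IsVariety (GeneratedVariety.{u, v} B) :=
  ⟨{e | Satisfies B e}, fun _ _ => Iff.rfl⟩

/-- `GeneratedVariety B` is the least variety that contains `B`. -/
theorem generatedVariety_least (B : Type u) [HeytingAlgebra B] :
    GeneratedVariety.{u, u} B B ∧
      ∀ K : HAClass.{u}, IsVariety K → K B → IsSubclass (GeneratedVariety.{u, u} B) K := by
  refine ⟨fun e he => he, ?_⟩
  rintro K ⟨E, hE⟩ hB A _ hA
  exact (hE A).2 fun e he => hA e ((hE B).1 hB e he)

/-! ### The epimorphism surjectivity property -/

/-- The homomorphism `f` is an epimorphism in (the category of members of) `K`. -/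
def IsEpiIn (K : HAClass.{u}) {A B : Type u} [HeytingAlgebra A] [HeytingAlgebra B]
    (f : HeytingHom A B) : Prop :=
  ∀ (C : Type u) [HeytingAlgebra C], K C →
    ∀ g h : HeytingHom B C, g.comp f = h.comp f → g = h

/-- `K` has the epimorphism surjectivity property: all epimorphisms between members of `K` are
surjective. -/
def HasES (K : HAClass.{u}) : Prop :=
  ∀ (A B : Type u) [HeytingAlgebra A] [HeytingAlgebra B], K A → K B →
    ∀ f : HeytingHom A B, IsEpiIn K f → Function.Surjective f

/-! ### Esakia spaces and Esakia duality on objects -/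

/-- Esakia spaces: compact Hausdorff spaces in which every open set is a union of clopen sets,
with a partial order such that principal upsets are closed and the downset generated by a clopen
set is clopen. -/
class EsakiaSpace (X : Type u) [TopologicalSpace X] [PartialOrder X] : Prop where
  compactSpace : CompactSpace X
  t2Space : T2Space X
  exists_isClopen : ∀ U : Set X, IsOpen U → ∀ x ∈ U, ∃ V, IsClopen V ∧ x ∈ V ∧ V ⊆ U
  isClosed_Ici : ∀ x : X, IsClosed (Set.Ici x)
  isClopen_lowerClosure : ∀ U : Set X, IsClopen U → IsClopen (lowerClosure U : Set X)

/-- The underlying set of the dual space of `A`: all prime filters of `A`. -/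
def DualSpace (A : Type u) [HeytingAlgebra A] : Type u :=
  {F : Order.PFilter A // F.IsPrime}

/-- Prime filters are ordered by inclusion. -/
instance (A : Type u) [HeytingAlgebra A] : PartialOrder (DualSpace A) :=
  inferInstanceAs (PartialOrder {F : Order.PFilter A // F.IsPrime})

/-- The set of prime filters that contain `a`. -/
def gammaSet {A : Type u} [HeytingAlgebra A] (a : A) : Set (DualSpace A) :=
  {F | a ∈ F.1}

/-- The topology with subbasis the sets `gammaSet a` and their complements. -/
instance (A : Type u) [HeytingAlgebra A] : TopologicalSpace (DualSpace A) :=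
  TopologicalSpace.generateFrom
    (Set.range (gammaSet (A := A)) ∪ Set.range fun a : A => (gammaSet a)ᶜ)

/-- `X` belongs to the dual class of `K`: it is isomorphic, as an ordered topological space, to
the dual space of a member of `K`. -/
def InDualClass (K : HAClass.{u}) (X : Type v) [TopologicalSpace X] [PartialOrder X]
    [EsakiaSpace X] : Prop :=
  ∃ (A : Type u) (_ : HeytingAlgebra A), K A ∧
    ∃ e : X ≃o DualSpace A, Continuous e ∧ Continuous e.symm

/-- The Heyting implication `U → V = X \ ↓(U \ V)` of clopen upsets of an Esakia space. -/
def clopenImp {X : Type u} [TopologicalSpace X] [PartialOrder X] [EsakiaSpace X]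
    (U V : ClopenUpperSet X) : ClopenUpperSet X where
  carrier := (lowerClosure ((U : Set X) \ (V : Set X)) : Set X)ᶜ
  isClopen' := (EsakiaSpace.isClopen_lowerClosure _ (U.isClopen.diff V.isClopen)).compl
  upper' := (lowerClosure ((U : Set X) \ (V : Set X))).lower.compl

theorem le_clopenImp_iff {X : Type u} [TopologicalSpace X] [PartialOrder X] [EsakiaSpace X]
    (U V W : ClopenUpperSet X) : U ≤ clopenImp V W ↔ U ⊓ V ≤ W := by
  constructor
  · rintro h x ⟨hU, hV⟩
    by_contra hW
    exact h hU (subset_lowerClosure ⟨hV, hW⟩)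
  · rintro h x hU ⟨y, ⟨hV, hW⟩, hxy⟩
    exact hW (h ⟨U.upper hxy hU, hV⟩)

/-- The Heyting algebra of clopen upsets of an Esakia space; meet and join are intersection and
union. -/
instance {X : Type u} [TopologicalSpace X] [PartialOrder X] [EsakiaSpace X] :
    HeytingAlgebra (ClopenUpperSet X) where
  himp := clopenImp
  le_himp_iff := le_clopenImp_iff
  bot_le _ := bot_le
  le_top _ := le_top
  compl U := clopenImp U ⊥
  himp_bot _ := rfl

/-! ### Width and incomparability degree -/

/-- No principal upset of `P` contains an antichain of `n + 1` elements. -/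
def WidthAtMost (n : ℕ) (P : Type u) [PartialOrder P] : Prop :=
  ∀ x : P, ¬ ∃ S : Finset P, S.card = n + 1 ∧ (S : Set P) ⊆ Set.Ici x ∧
    IsAntichain (· ≤ ·) (S : Set P)

/-- No principal upset of `P`, regarded as a poset, contains a point that is incomparable with
`n + 1` of its elements. -/
def IncomparabilityDegreeAtMost (n : ℕ) (P : Type u) [PartialOrder P] : Prop :=
  ∀ x : P, ∀ y ∈ Set.Ici x, ¬ ∃ S : Finset P, S.card = n + 1 ∧ (S : Set P) ⊆ Set.Ici x ∧
    ∀ z ∈ S, ¬ y ≤ z ∧ ¬ z ≤ y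

/-- The class of Heyting algebras of width at most `n`. -/
def ClassW (n : ℕ) : HAClass.{u} := fun A _ => WidthAtMost n (DualSpace A)

/-- The class of Heyting algebras of incomparability degree at most `n`. -/
def ClassID (n : ℕ) : HAClass.{u} := fun A _ => IncomparabilityDegreeAtMost n (DualSpace A)

/-- The class of Heyting algebras of incomparability degree at most `2` and width at most `2`. -/
def ClassID2W2 : HAClass.{u} := fun A _ => ClassID 2 A ∧ ClassW 2 A

/-! ### Infinite sums of Esakia spaces -/

/-- The universe of the sum of the spaces `X 0, X 1, …`: their disjoint union and a new point. -/
inductive SpaceSum (X : ℕ → Type u) : Type u where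
  | top : SpaceSum X
  | pt : (n : ℕ) → X n → SpaceSum X

namespace SpaceSum

variable {X : ℕ → Type u}

/-- The order of the sum: `X (n + 1)` is placed above `X n`, and `top` is the greatest element. -/
inductive Le [∀ n, PartialOrder (X n)] : SpaceSum X → SpaceSum X → Prop where
  | le_top (a : SpaceSum X) : Le a top
  | same (n : ℕ) (x y : X n) : x ≤ y → Le (pt n x) (pt n y)
  | lt (n m : ℕ) (x : X n) (y : X m) : n < m → Le (pt n x) (pt m y)

instance [∀ n, PartialOrder (X n)] : PartialOrder (SpaceSum X) where
  le := Le
  le_refl a := by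
    cases a with
    | top => exact Le.le_top _
    | pt n x => exact Le.same n x x le_rfl
  le_trans a b c hab hbc := by
    cases hbc with
    | le_top => exact Le.le_top _
    | same n x y h =>
      cases hab with
      | same _ w _ h' => exact Le.same _ _ _ (h'.trans h)
      | lt _ _ _ _ h' => exact Le.lt _ _ _ _ h'
    | lt n m x y h =>
      cases hab with
      | same _ w _ h' => exact Le.lt _ _ _ _ h
      | lt _ _ _ _ h' => exact Le.lt _ _ _ _ (h'.trans h)
  le_antisymm a b hab hba := by
    cases hab with
    | le_top => cases hba; rfl
    | same n x y h =>
      cases hba with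
      | same _ _ _ h' => rw [le_antisymm h h']
      | lt _ _ _ _ h' => exact absurd h' (lt_irrefl _)
    | lt n m x y h =>
      cases hba with
      | same _ _ _ h' => exact absurd h (lt_irrefl _)
      | lt _ _ _ _ h' => exact absurd h' h.asymm

/-- A set is open when its trace on every `X n` is open and, if it contains `top`, it contains all
but finitely many of the `X n`. -/
instance [∀ n, TopologicalSpace (X n)] : TopologicalSpace (SpaceSum X) where
  IsOpen U := (∀ n, IsOpen (pt n ⁻¹' U)) ∧ (top ∈ U → ∃ n, ∀ m, n ≤ m → ∀ x : X m, pt m x ∈ U)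
  isOpen_univ := ⟨fun _ => isOpen_univ, fun _ => ⟨0, fun _ _ _ => trivial⟩⟩
  isOpen_inter U V hU hV := by
    refine ⟨fun n => (hU.1 n).inter (hV.1 n), fun h => ?_⟩
    obtain ⟨k, hk⟩ := hU.2 h.1
    obtain ⟨l, hl⟩ := hV.2 h.2
    exact ⟨max k l, fun m hm x =>
      ⟨hk m ((le_max_left _ _).trans hm) x, hl m ((le_max_right _ _).trans hm) x⟩⟩
  isOpen_sUnion S hS := by
    refine ⟨fun n => ?_, ?_⟩
    · rw [Set.preimage_sUnion]
      exact isOpen_biUnion fun U hU => (hS U hU).1 n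
    · rintro ⟨U, hU, hT⟩
      obtain ⟨k, hk⟩ := (hS U hU).2 hT
      exact ⟨k, fun m hm x => ⟨U, hU, hk m hm x⟩⟩

section order

variable [∀ n, PartialOrder (X n)]

theorem le_def (a b : SpaceSum X) : a ≤ b ↔ Le a b := Iff.rfl

theorem pt_le_pt_same {n : ℕ} {x y : X n} : pt n x ≤ pt n y ↔ x ≤ y := by
  refine ⟨fun h => ?_, fun h => Le.same _ _ _ h⟩
  cases h with
  | same _ _ _ h' => exact h'
  | lt _ _ _ _ h' => exact absurd h' (lt_irrefl _)

theorem pt_le_pt_of_ne {n m : ℕ} {x : X n} {y : X m} (hnm : n ≠ m) :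
    pt n x ≤ pt m y ↔ n < m := by
  refine ⟨fun h => ?_, fun h => Le.lt _ _ _ _ h⟩
  cases h with
  | same _ _ _ _ => exact absurd rfl hnm
  | lt _ _ _ _ h' => exact h'

theorem not_top_le_pt {n : ℕ} {x : X n} : ¬ (top : SpaceSum X) ≤ pt n x := by
  intro h
  cases h

end order

theorem preimage_image_pt_of_ne {n m : ℕ} (h : m ≠ n) (V : Set (X n)) :
    (pt m : X m → SpaceSum X) ⁻¹' (pt n '' V) = ∅ := by
  ext x
  simp only [Set.mem_preimage, Set.mem_image, Set.mem_empty_iff_false, iff_false]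
  rintro ⟨y, -, hy⟩
  cases hy
  exact h rfl

theorem preimage_image_pt_self (n : ℕ) (V : Set (X n)) :
    (pt n : X n → SpaceSum X) ⁻¹' (pt n '' V) = V := by
  ext x
  simp

section topology

variable [∀ n, TopologicalSpace (X n)]

theorem isOpen_def (U : Set (SpaceSum X)) : IsOpen U ↔
    (∀ n, IsOpen (pt n ⁻¹' U)) ∧ (top ∈ U → ∃ n, ∀ m, n ≤ m → ∀ x : X m, pt m x ∈ U) :=
  Iff.rfl

theorem continuous_pt (n : ℕ) : Continuous (pt n : X n → SpaceSum X) :=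
  ⟨fun _ hU => hU.1 n⟩

theorem isClopen_image_pt (n : ℕ) (V : Set (X n)) (hV : IsClopen V) :
    IsClopen (pt n '' V : Set (SpaceSum X)) := by
  refine ⟨⟨⟨fun m => ?_, fun _ => ⟨n + 1, fun m hm x => ?_⟩⟩⟩, ⟨fun m => ?_, ?_⟩⟩
  · rw [Set.preimage_compl]
    by_cases h : m = n
    · subst h
      rw [preimage_image_pt_self]
      exact hV.compl.isOpen
    · rw [preimage_image_pt_of_ne h]
      simp
  · rintro ⟨y, -, hy⟩
    cases hy
    omega
  · by_cases h : m = n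
    · subst h
      rw [preimage_image_pt_self]
      exact hV.isOpen
    · rw [preimage_image_pt_of_ne h]
      exact isOpen_empty
  · rintro ⟨y, -, hy⟩
    cases hy

/-- The points of index at least `n`, and `top`. -/
def tail (X : ℕ → Type u) (n : ℕ) : Set (SpaceSum X) := {a | ∀ m x, a = pt m x → n ≤ m}

theorem isClopen_tail (n : ℕ) : IsClopen (tail X n) := by
  have h1 : ∀ m, (pt m ⁻¹' tail X n : Set (X m)) = {_x | n ≤ m} := by
    intro m
    ext x
    simp only [tail, Set.mem_preimage, Set.mem_ofPred_eq]
    refine ⟨fun h => h m x rfl, ?_⟩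
    intro h k y hy
    cases hy
    exact h
  have h2 : top ∈ tail X n := by
    intro m x h
    cases h
  refine ⟨⟨⟨fun m => ?_, fun h => absurd h2 h⟩⟩, ⟨fun m => ?_, fun _ => ⟨n, fun m hm x => ?_⟩⟩⟩
  · rw [Set.preimage_compl, h1, isOpen_compl_iff]
    exact isClosed_const
  · rw [h1]
    exact isOpen_const
  · change x ∈ pt m ⁻¹' tail X n
    rw [h1]
    exact hm

theorem exists_clopen_subset (hX : ∀ n, ∀ U : Set (X n), IsOpen U → ∀ x ∈ U,
      ∃ V, IsClopen V ∧ x ∈ V ∧ V ⊆ U)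
    (U : Set (SpaceSum X)) (hU : IsOpen U) (a : SpaceSum X) (ha : a ∈ U) :
    ∃ V, IsClopen V ∧ a ∈ V ∧ V ⊆ U := by
  cases a with
  | top =>
    obtain ⟨n, hn⟩ := hU.2 ha
    refine ⟨tail X n, isClopen_tail n, ?_, ?_⟩
    · intro m x h
      cases h
    · intro b hb
      cases b with
      | top => exact ha
      | pt m x => exact hn m (hb m x rfl) x
  | pt n x =>
    obtain ⟨V, hV, hxV, hVU⟩ := hX n _ (hU.1 n) x ha
    refine ⟨pt n '' V, isClopen_image_pt n V hV, ⟨x, hxV, rfl⟩, ?_⟩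
    rintro _ ⟨y, hy, rfl⟩
    exact hVU hy

theorem compactSpace_of (hX : ∀ n, CompactSpace (X n)) : CompactSpace (SpaceSum X) := by
  refine ⟨isCompact_iff_ultrafilter_le_nhds.2 fun F _ => ?_⟩
  by_cases h : ∃ n, Set.range (pt n : X n → SpaceSum X) ∈ F
  · obtain ⟨n, hn⟩ := h
    obtain ⟨a, -, ha⟩ := isCompact_iff_ultrafilter_le_nhds.1
      (isCompact_range (continuous_pt (X := X) n)) F (Filter.le_principal_iff.2 hn)
    exact ⟨a, trivial, ha⟩
  · push Not at h
    refine ⟨top, trivial, ?_⟩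
    intro U hU
    obtain ⟨V, hVU, hV, hT⟩ := mem_nhds_iff.1 hU
    obtain ⟨n, hn⟩ := hV.2 hT
    have h3 : (⋂ m ∈ Finset.range n, (Set.range (pt m : X m → SpaceSum X))ᶜ) ∈ F :=
      (Filter.biInter_finset_mem _).2 fun m _ => Ultrafilter.compl_mem_iff_notMem.2 (h m)
    refine Filter.mem_of_superset h3 fun a ha => hVU ?_
    cases a with
    | top => exact hT
    | pt m x =>
      refine hn m ?_ x
      by_contra hm
      exact (Set.mem_iInter₂.1 ha m (Finset.mem_range.2 (not_le.1 hm))) ⟨x, rfl⟩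

theorem t2Space_of (hX : ∀ n, ∀ U : Set (X n), IsOpen U → ∀ x ∈ U,
      ∃ V, IsClopen V ∧ x ∈ V ∧ V ⊆ U) (hX' : ∀ n, T2Space (X n)) : T2Space (SpaceSum X) := by
  have key : ∀ (n : ℕ) (x : X n) (b : SpaceSum X), b ≠ pt n x →
      ∃ V, IsClopen V ∧ pt n x ∈ V ∧ b ∉ V := by
    intro n x b hb
    cases b with
    | top =>
      refine ⟨pt n '' Set.univ, isClopen_image_pt n _ isClopen_univ, ⟨x, trivial, rfl⟩, ?_⟩
      rintro ⟨y, -, hy⟩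
      cases hy
    | pt m y =>
      by_cases h : m = n
      · subst h
        have hne : x ≠ y := fun h => hb (by rw [h])
        obtain ⟨V, hV, hxV, hVU⟩ := hX m {y}ᶜ isOpen_compl_singleton x hne
        refine ⟨pt m '' V, isClopen_image_pt m _ hV, ⟨x, hxV, rfl⟩, ?_⟩
        rintro ⟨z, hz, hzy⟩
        cases hzy
        exact hVU hz rfl
      · refine ⟨pt n '' Set.univ, isClopen_image_pt n _ isClopen_univ, ⟨x, trivial, rfl⟩, ?_⟩
        rintro ⟨z, -, hzy⟩
        cases hzy
        exact h rfl
  refine ⟨fun a b hab => ?_⟩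
  cases a with
  | pt n x =>
    obtain ⟨V, hV, h1, h2⟩ := key n x b hab.symm
    exact ⟨V, Vᶜ, hV.isOpen, hV.compl.isOpen, h1, h2, disjoint_compl_right⟩
  | top =>
    cases b with
    | top => exact absurd rfl hab
    | pt n x =>
      obtain ⟨V, hV, h1, h2⟩ := key n x top hab
      exact ⟨Vᶜ, V, hV.compl.isOpen, hV.isOpen, h2, h1, disjoint_compl_left⟩

end topology

/-- The sum of a sequence of Esakia spaces is an Esakia space. -/
instance [∀ n, TopologicalSpace (X n)] [∀ n, PartialOrder (X n)] [∀ n, EsakiaSpace (X n)] :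
    EsakiaSpace (SpaceSum X) where
  compactSpace := compactSpace_of fun _ => EsakiaSpace.compactSpace
  t2Space := t2Space_of (fun _ => EsakiaSpace.exists_isClopen) fun _ => EsakiaSpace.t2Space
  exists_isClopen := exists_clopen_subset fun _ => EsakiaSpace.exists_isClopen
  isClosed_Ici a := by
    refine ⟨⟨fun m => ?_, fun h => absurd (Le.le_top a) h⟩⟩
    rw [Set.preimage_compl, isOpen_compl_iff]
    cases a with
    | top =>
      have : (pt m ⁻¹' Set.Ici top : Set (X m)) = ∅ := by
        ext x
        simpa using not_top_le_pt
      rw [this]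
      exact isClosed_empty
    | pt n x =>
      by_cases h : n = m
      · subst h
        have : (pt n ⁻¹' Set.Ici (pt n x) : Set (X n)) = Set.Ici x := by
          ext y
          exact pt_le_pt_same
        rw [this]
        exact EsakiaSpace.isClosed_Ici x
      · have : (pt m ⁻¹' Set.Ici (pt n x) : Set (X m)) = {_y | n < m} := by
          ext y
          exact pt_le_pt_of_ne h
        rw [this]
        exact isClosed_const
  isClopen_lowerClosure U hU := by
    by_cases hT : top ∈ U
    · have : (lowerClosure U : Set (SpaceSum X)) = Set.univ :=
        Set.eq_univ_of_forall fun a => ⟨top, hT, Le.le_top a⟩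
      rw [this]
      exact isClopen_univ
    · have hT' : top ∉ (lowerClosure U : Set (SpaceSum X)) := by
        rintro ⟨b, hb, hle⟩
        cases hle
        exact hT hb
      have key : ∀ n, IsClopen (pt n ⁻¹' (lowerClosure U : Set (SpaceSum X)) : Set (X n)) := by
        intro n
        by_cases h : ∃ m, n < m ∧ ∃ y : X m, pt m y ∈ U
        · obtain ⟨m, hm, y, hy⟩ := h
          have : (pt n ⁻¹' (lowerClosure U : Set (SpaceSum X)) : Set (X n)) = Set.univ :=
            Set.eq_univ_of_forall fun x => ⟨pt m y, hy, Le.lt _ _ _ _ hm⟩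
          rw [this]
          exact isClopen_univ
        · have : (pt n ⁻¹' (lowerClosure U : Set (SpaceSum X)) : Set (X n)) =
              (lowerClosure (pt n ⁻¹' U) : Set (X n)) := by
            ext x
            constructor
            · rintro ⟨b, hb, hle⟩
              cases hle with
              | le_top => exact absurd hb hT
              | same _ _ y hxy => exact ⟨y, hb, hxy⟩
              | lt _ m _ y hnm => exact absurd ⟨m, hnm, y, hb⟩ h
            · rintro ⟨y, hy, hle⟩
              exact ⟨pt n y, hy, Le.same _ _ _ hle⟩
          rw [this]
          exact EsakiaSpace.isClopen_lowerClosure _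
            (hU.preimage (continuous_pt n))
      obtain ⟨N, hN⟩ := hU.compl.isOpen.2 hT
      refine ⟨⟨⟨fun n => (key n).compl.isOpen, fun _ => ⟨N, fun m hm x => ?_⟩⟩⟩,
        ⟨fun n => (key n).isOpen, fun h => absurd h hT'⟩⟩
      rintro ⟨b, hb, hle⟩
      cases hle with
      | le_top => exact hT hb
      | same _ _ y _ => exact hN m hm y hb
      | lt _ k _ y hnm => exact hN k (hm.trans hnm.le) y hb

end SpaceSum

/-! ### The spaces `D₂` and `D₂^∞` -/

/-- The two-element set underlying `D₂`. -/
inductive D2 : Type where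
  | left : D2
  | right : D2

/-- The two points of `D₂` are incomparable. -/
instance : PartialOrder D2 where
  le x y := x = y
  le_refl _ := rfl
  le_trans _ _ _ h h' := h.trans h'
  le_antisymm _ _ h _ := h

/-- `D₂` carries the discrete topology. -/
instance : TopologicalSpace D2 := ⊥

instance : DiscreteTopology D2 := ⟨rfl⟩

instance : Finite D2 :=
  Finite.of_injective (fun x : D2 => match x with
    | D2.left => true
    | D2.right => false) (by
      intro x y h
      cases x <;> cases y <;> simp_all)

instance : EsakiaSpace D2 where
  compactSpace := inferInstance
  t2Space := inferInstance
  exists_isClopen U _ x hx := ⟨U, isClopen_discrete U, hx, subset_rfl⟩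
  isClosed_Ici _ := isClosed_discrete _
  isClopen_lowerClosure _ _ := isClopen_discrete _

/-- `D₂^∞`, the sum of countably many copies of `D₂`. -/
abbrev D2Infinity : Type := SpaceSum fun _ : ℕ => D2

/-! ### The Rieger–Nishimura lattice -/

/-- The poset of join-irreducible elements `w 0, w 1, w 2, …` of the Rieger–Nishimura lattice. -/
structure RNLadder : Type where
  index : ℕ

/-- `w m < w n` if and only if `m + 2 ≤ n`. -/
instance : PartialOrder RNLadder where
  le x y := x = y ∨ x.index + 2 ≤ y.index
  le_refl _ := Or.inl rfl
  le_trans x y z h h' := by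
    rcases h with rfl | h
    · exact h'
    · rcases h' with rfl | h'
      · exact Or.inr h
      · right
        omega
  le_antisymm x y h h' := by
    rcases h with h | h
    · exact h
    · rcases h' with h' | h'
      · exact h'.symm
      · omega

/-- The Rieger–Nishimura lattice, with Mathlib's Heyting algebra structure on lower sets. Its
elements are the empty set, the sets `↓w n = {w n} ∪ {w i | i + 2 ≤ n}`, the sets
`a n = {w 0, …, w n}` with `n ≥ 1`, and the whole ladder. Hence the covers of `↓w 0` are `a 1` and
`↓w 2`, those of `↓w 1` are only `a 1`, and `a n = ↓w n ∪ ↓w (n - 1)` is covered by `a (n + 1)` and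
`↓w (n + 2)`. -/
abbrev RiegerNishimura : Type := LowerSet RNLadder

/-- The list of the elements of the Rieger–Nishimura lattice. -/
theorem riegerNishimura_cases (s : RiegerNishimura) :
    s = ⊥ ∨ (∃ n, s = LowerSet.Iic ⟨n⟩) ∨ (∃ n, 1 ≤ n ∧ ∀ w, w ∈ s ↔ w.index ≤ n) ∨ s = ⊤ := by
  rcases Set.finite_or_infinite {n : ℕ | (⟨n⟩ : RNLadder) ∈ s} with hfin | hinf
  · rcases Set.eq_empty_or_nonempty {n : ℕ | (⟨n⟩ : RNLadder) ∈ s} with he | hne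
    · left
      ext w
      have : w.index ∉ {n : ℕ | (⟨n⟩ : RNLadder) ∈ s} := by simp [he]
      simpa using this
    · obtain ⟨N, hN, hmax⟩ := Set.exists_max_image _ id hfin hne
      have hle : ∀ w ∈ s, w.index ≤ N := fun w hw => hmax w.index hw
      have hlow : ∀ w : RNLadder, w.index + 2 ≤ N → w ∈ s := fun w hw =>
        s.lower (show w ≤ ⟨N⟩ from Or.inr hw) hN
      by_cases h1 : 1 ≤ N ∧ (⟨N - 1⟩ : RNLadder) ∈ s
      · refine Or.inr (Or.inr (Or.inl ⟨N, h1.1, fun w => ⟨hle w, fun hw => ?_⟩⟩))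
        obtain ⟨k⟩ := w
        change k ≤ N at hw
        rcases (by omega : k = N ∨ k = N - 1 ∨ k + 2 ≤ N) with h | h | h
        · rw [h]
          exact hN
        · rw [h]
          exact h1.2
        · exact hlow ⟨k⟩ h
      · refine Or.inr (Or.inl ⟨N, ?_⟩)
        ext w
        constructor
        · intro hw
          have hw' := hle w hw
          obtain ⟨k⟩ := w
          change k ≤ N at hw'
          rcases (by omega : k = N ∨ (1 ≤ N ∧ k = N - 1) ∨ k + 2 ≤ N) with h | h | h
          · exact Or.inl (by rw [h])
          · exact absurd ⟨h.1, h.2 ▸ hw⟩ h1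
          · exact Or.inr h
        · intro hw
          exact s.lower hw hN
  · right; right; right
    ext w
    refine ⟨fun _ => trivial, fun _ => ?_⟩
    obtain ⟨n, hn, hlt⟩ := hinf.exists_gt (w.index + 2)
    exact s.lower (show w ≤ ⟨n⟩ from Or.inr hlt.le) hn

end HeytingES

namespace HeytingES

/-! ### Forcing relations -/

/-- `φ` presents the elements of the Heyting algebra `A` as subsets of a frame, the operations
being computed as in Kripke semantics with accessibility relation `R`. -/
structure IsForcing {P A : Type*} [HeytingAlgebra A] (R : P → P → Prop) (φ : P → A → Prop) :
    Prop where
  top : ∀ p, φ p ⊤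
  bot : ∀ p, ¬ φ p ⊥
  inf : ∀ p a b, φ p (a ⊓ b) ↔ φ p a ∧ φ p b
  sup : ∀ p a b, φ p (a ⊔ b) ↔ φ p a ∨ φ p b
  himp : ∀ p a b, φ p (a ⇨ b) ↔ ∀ q, R p q → φ q a → φ q b

/-- Forcing is preserved by bisimulations. -/
theorem IsForcing.eval_iff {P A Q B : Type*} [HeytingAlgebra A] [HeytingAlgebra B]
    {R : P → P → Prop} {φ : P → A → Prop} {S : Q → Q → Prop} {ψ : Q → B → Prop}
    (hφ : IsForcing R φ) (hψ : IsForcing S ψ) (Z : P → Q → Prop)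
    (forth : ∀ p q p', Z p q → R p p' → ∃ q', S q q' ∧ Z p' q')
    (back : ∀ p q q', Z p q → S q q' → ∃ p', R p p' ∧ Z p' q')
    (v : ℕ → A) (w : ℕ → B) (hvw : ∀ n p q, Z p q → (φ p (v n) ↔ ψ q (w n))) (t : HTerm) :
    ∀ p q, Z p q → (φ p (t.eval v) ↔ ψ q (t.eval w)) := by
  induction t with
  | var n => exact hvw n
  | bot => exact fun p q _ => iff_of_false (hφ.bot p) (hψ.bot q)
  | top => exact fun p q _ => iff_of_true (hφ.top p) (hψ.top q)
  | inf s t hs ht =>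
    intro p q h
    simp only [HTerm.eval, hφ.inf, hψ.inf, hs p q h, ht p q h]
  | sup s t hs ht =>
    intro p q h
    simp only [HTerm.eval, hφ.sup, hψ.sup, hs p q h, ht p q h]
  | imp s t hs ht =>
    intro p q h
    simp only [HTerm.eval, hφ.himp, hψ.himp]
    constructor
    · intro H q' hq hq'
      obtain ⟨p', hp, hz⟩ := back p q q' h hq
      exact (ht p' q' hz).1 (H p' hp ((hs p' q' hz).2 hq'))
    · intro H p' hp hp'
      obtain ⟨q', hq, hz⟩ := forth p q p' h hp
      exact (ht p' q' hz).2 (H q' hq ((hs p' q' hz).1 hp'))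

/-- Equations are inherited along a bisimulation through which every valuation can be transferred
and which reaches enough points. -/
theorem satisfies_of_bisimulation {P A Q B : Type*} [HeytingAlgebra A] [HeytingAlgebra B]
    {R : P → P → Prop} {φ : P → A → Prop} {S : Q → Q → Prop} {ψ : Q → B → Prop}
    (hφ : IsForcing R φ) (hψ : IsForcing S ψ) (Z : P → Q → Prop)
    (forth : ∀ p q p', Z p q → R p p' → ∃ q', S q q' ∧ Z p' q')
    (back : ∀ p q q', Z p q → S q q' → ∃ p', R p p' ∧ Z p' q')
    (val : ∀ a : A, ∃ b : B, ∀ p q, Z p q → (φ p a ↔ ψ q b))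
    (ext : ∀ a b : A, (∀ p q, Z p q → (φ p a ↔ φ p b)) → a = b)
    (e : HTerm × HTerm) (he : Satisfies B e) : Satisfies A e := by
  intro v
  choose f hf using val
  have h := hφ.eval_iff hψ Z forth back v (fun n => f (v n)) (fun n => hf (v n))
  refine ext _ _ fun p q hz => ?_
  rw [h e.1 p q hz, h e.2 p q hz, he]

theorem eval_map {A B : Type*} [HeytingAlgebra A] [HeytingAlgebra B] (f : HeytingHom A B)
    (v : ℕ → A) (t : HTerm) : f (t.eval v) = t.eval fun n => f (v n) := by
  induction t <;> simp_all [HTerm.eval]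

theorem Satisfies.of_injective {A B : Type*} [HeytingAlgebra A] [HeytingAlgebra B]
    {f : HeytingHom A B} (hf : Function.Injective f) {e : HTerm × HTerm} (h : Satisfies B e) :
    Satisfies A e := by
  intro v
  apply hf
  rw [eval_map, eval_map, h]

theorem IsVariety.of_satisfies {K : HAClass.{u}} (hK : IsVariety K) {A B : Type u}
    [HeytingAlgebra A] [HeytingAlgebra B] (hB : K B)
    (h : ∀ e, Satisfies B e → Satisfies A e) : K A := by
  obtain ⟨E, hE⟩ := hK
  exact (hE A).2 fun e he => h e ((hE B).1 hB e he)

/-! ### Prime filters -/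

section PrimeFilter

variable {A : Type u} {B : Type v} [HeytingAlgebra A] [HeytingAlgebra B]

/-- The membership predicate of a prime filter. -/
structure IsPrimePred (T : A → Prop) : Prop where
  top : T ⊤
  bot : ¬ T ⊥
  inf : ∀ a b, T (a ⊓ b) ↔ T a ∧ T b
  sup : ∀ a b, T (a ⊔ b) ↔ T a ∨ T b

theorem IsForcing.isPrimePred {P : Type*} {R : P → P → Prop} {φ : P → A → Prop}
    (h : IsForcing R φ) (p : P) : IsPrimePred (φ p) :=
  ⟨h.top p, h.bot p, h.inf p, h.sup p⟩

theorem IsPrimePred.mono {T : A → Prop} (hT : IsPrimePred T) {a b : A} (hab : a ≤ b) (ha : T a) :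
    T b := by
  rw [← inf_eq_left.2 hab, hT.inf] at ha
  exact ha.2

theorem IsPrimePred.finset_sup {T : A → Prop} (hT : IsPrimePred T) {ι : Type*} (s : Finset ι)
    (f : ι → A) (h : T (s.sup f)) : ∃ i ∈ s, T (f i) := by
  classical
  induction s using Finset.induction_on with
  | empty => exact absurd h hT.bot
  | insert i s _ ih =>
    rw [Finset.sup_insert, hT.sup] at h
    rcases h with h | h
    · exact ⟨i, Finset.mem_insert_self _ _, h⟩
    · obtain ⟨j, hj, h⟩ := ih h
      exact ⟨j, Finset.mem_insert_of_mem hj, h⟩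

theorem isPrimePred_mem (w : DualSpace A) : IsPrimePred fun a => a ∈ w.1 where
  top := Order.PFilter.top_mem
  bot h := by
    obtain ⟨b, hb⟩ := w.2.compl_ideal.toIdeal.nonempty
    exact hb (Order.PFilter.mem_of_le bot_le h)
  inf _ _ := Order.PFilter.inf_mem_iff
  sup a b := by
    refine ⟨fun h => ?_, fun h => h.elim (Order.PFilter.mem_of_le le_sup_left)
      (Order.PFilter.mem_of_le le_sup_right)⟩
    by_contra! hab
    exact (Order.Ideal.sup_mem (s := w.2.compl_ideal.toIdeal) hab.1 hab.2) h

/-- The prime filter theorem. -/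
theorem exists_dualSpace_of_disjoint (F : Order.PFilter A) (I : Order.Ideal A)
    (h : Disjoint (F : Set A) I) : ∃ w : DualSpace A, F ≤ w.1 ∧ ∀ a ∈ I, a ∉ w.1 := by
  obtain ⟨J, hJ, hIJ, hFJ⟩ := DistribLattice.prime_ideal_of_disjoint_filter_ideal h
  refine ⟨⟨_, hJ.toPrimePair.F_isPrime⟩, ?_, ?_⟩
  · intro a ha haJ
    exact Set.disjoint_left.1 hFJ ha haJ
  · intro a ha haJ
    exact haJ (hIJ ha)

/-- The prime filter theorem for the filter generated by a meet-closed set and an element. -/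
theorem exists_le_dualSpace (w : DualSpace A) {X Y : A → Prop} (hXt : X ⊤)
    (hX : ∀ a b, X a → X b → X (a ⊓ b)) (hYb : Y ⊥) (hY : ∀ a b, Y a → Y b → Y (a ⊔ b))
    (h : ∀ c ∈ w.1, ∀ a b, X a → Y b → ¬ c ⊓ a ≤ b) :
    ∃ w' : DualSpace A, w ≤ w' ∧ (∀ a, X a → a ∈ w'.1) ∧ ∀ b, Y b → b ∉ w'.1 := by
  have hF : Order.IsPFilter {d : A | ∃ c ∈ w.1, ∃ a, X a ∧ c ⊓ a ≤ d} := by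
    refine Order.IsPFilter.of_def ⟨⊤, ⊤, (isPrimePred_mem w).top, ⊤, hXt, le_top⟩ ?_ ?_
    · rintro d ⟨c, hc, a, ha, hd⟩ d' ⟨c', hc', a', ha', hd'⟩
      exact ⟨d ⊓ d', ⟨c ⊓ c', Order.PFilter.inf_mem hc hc', a ⊓ a', hX _ _ ha ha',
        le_inf ((inf_le_inf inf_le_left inf_le_left).trans hd)
          ((inf_le_inf inf_le_right inf_le_right).trans hd')⟩, inf_le_left, inf_le_right⟩
    · rintro d d' hdd ⟨c, hc, a, ha, hd⟩
      exact ⟨c, hc, a, ha, hd.trans hdd⟩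
  have hI : Order.IsIdeal {d : A | ∃ b, Y b ∧ d ≤ b} := by
    refine ⟨fun d d' hdd => ?_, ⟨⊥, ⊥, hYb, le_rfl⟩, ?_⟩
    · rintro ⟨b, hb, hd⟩
      exact ⟨b, hb, hdd.trans hd⟩
    · rintro d ⟨b, hb, hd⟩ d' ⟨b', hb', hd'⟩
      exact ⟨d ⊔ d', ⟨b ⊔ b', hY _ _ hb hb', sup_le_sup hd hd'⟩, le_sup_left, le_sup_right⟩
  obtain ⟨w', h1, h2⟩ := exists_dualSpace_of_disjoint hF.toPFilter hI.toIdeal (by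
    refine Set.disjoint_left.2 ?_
    rintro d ⟨c, hc, a, ha, hd⟩ ⟨b, hb, hd'⟩
    exact h c hc a b ha hb (hd.trans hd'))
  exact ⟨w', fun c hc => h1 ⟨c, hc, ⊤, hXt, inf_le_left⟩,
    fun a ha => h1 ⟨⊤, (isPrimePred_mem w).top, a, ha, inf_le_right⟩,
    fun b hb => h2 b ⟨b, hb, le_rfl⟩⟩

theorem isForcing_dualSpace : IsForcing (· ≤ ·) fun (w : DualSpace A) (a : A) => a ∈ w.1 where
  top w := (isPrimePred_mem w).top
  bot w := (isPrimePred_mem w).bot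
  inf w := (isPrimePred_mem w).inf
  sup w := (isPrimePred_mem w).sup
  himp w a b := by
    constructor
    · intro h w' hw ha
      exact Order.PFilter.mem_of_le himp_inf_le (Order.PFilter.inf_mem (hw h) ha)
    · intro h
      by_contra hab
      obtain ⟨w', h1, h2, h3⟩ := exists_le_dualSpace w (X := fun c => a ≤ c) (Y := fun c => c ≤ b)
        le_top (fun _ _ => le_inf) bot_le (fun _ _ => sup_le) (by
          intro c hc a' b' ha' hb' hle
          exact hab (Order.PFilter.mem_of_le
            (le_himp_iff.2 ((inf_le_inf le_rfl ha').trans (hle.trans hb'))) hc))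
      exact h3 b le_rfl (h w' h1 (h2 a le_rfl))

theorem exists_mem_notMem {a b : A} (h : ¬ a ≤ b) : ∃ w : DualSpace A, a ∈ w.1 ∧ b ∉ w.1 := by
  obtain ⟨w, h1, h2⟩ := exists_dualSpace_of_disjoint (Order.PFilter.principal a)
    (Order.Ideal.principal b)
    (Set.disjoint_left.2 fun c (hc : a ≤ c) (hc' : c ≤ b) => h (hc.trans hc'))
  exact ⟨w, h1 (Order.PFilter.mem_principal.2 le_rfl), h2 b (Order.Ideal.mem_principal.2 le_rfl)⟩

theorem eq_of_forall_mem_iff {a b : A} (h : ∀ w : DualSpace A, a ∈ w.1 ↔ b ∈ w.1) : a = b := by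
  by_contra hne
  rcases not_and_or.1 (mt (fun hab => le_antisymm hab.1 hab.2) hne) with h' | h'
  · obtain ⟨w, h1, h2⟩ := exists_mem_notMem h'
    exact h2 ((h w).1 h1)
  · obtain ⟨w, h1, h2⟩ := exists_mem_notMem h'
    exact h2 ((h w).2 h1)

theorem DualSpace.not_le_iff {w w' : DualSpace A} : ¬ w ≤ w' ↔ ∃ a, a ∈ w.1 ∧ a ∉ w'.1 :=
  Set.not_subset

/-- The dual of a homomorphism has the back property of a p-morphism. -/
theorem exists_le_dualSpace_comap (g : HeytingHom B A) (w : DualSpace A) {T : B → Prop}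
    (hT : IsPrimePred T) (h : ∀ b, g b ∈ w.1 → T b) :
    ∃ w' : DualSpace A, w ≤ w' ∧ ∀ b, g b ∈ w'.1 ↔ T b := by
  obtain ⟨w', h1, h2, h3⟩ := exists_le_dualSpace w (X := fun a => ∃ b, T b ∧ g b = a)
    (Y := fun a => ∃ b, ¬ T b ∧ g b = a) ⟨⊤, hT.top, map_top g⟩
    (by
      rintro _ _ ⟨b, hb, rfl⟩ ⟨b', hb', rfl⟩
      exact ⟨b ⊓ b', (hT.inf _ _).2 ⟨hb, hb'⟩, map_inf g b b'⟩)
    ⟨⊥, hT.bot, map_bot g⟩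
    (by
      rintro _ _ ⟨b, hb, rfl⟩ ⟨b', hb', rfl⟩
      exact ⟨b ⊔ b', fun h => ((hT.sup _ _).1 h).elim hb hb', map_sup g b b'⟩)
    (by
      rintro c hc _ _ ⟨b, hb, rfl⟩ ⟨b', hb', rfl⟩ hle
      have : g (b ⇨ b') ∈ w.1 := by
        rw [map_himp]
        exact Order.PFilter.mem_of_le (le_himp_iff.2 hle) hc
      exact hb' (hT.mono himp_inf_le ((hT.inf _ _).2 ⟨h _ this, hb⟩)))
  refine ⟨w', h1, fun b => ⟨fun hb => ?_, fun hb => h2 _ ⟨b, hb, rfl⟩⟩⟩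
  by_contra hT'
  exact h3 _ ⟨b, hT', rfl⟩ hb

end PrimeFilter

/-- Sets in the lattice of lower sets of a poset are forced at the points they contain. -/
theorem isForcing_lowerSet (Q : Type*) [Preorder Q] :
    IsForcing (fun x y : Q => y ≤ x) fun (x : Q) (U : LowerSet Q) => x ∈ U where
  top _ := trivial
  bot _ h := h
  inf _ _ _ := Iff.rfl
  sup _ _ _ := Iff.rfl
  himp x U V := by
    rw [← LowerSet.Iic_le, le_himp_iff]
    exact ⟨fun h y hy hU => h ⟨hy, hU⟩, fun h y hy => h y hy.1 hy.2⟩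

/-- Clopen upsets of an Esakia space are forced at the points they contain. -/
theorem isForcing_clopenUpperSet (X : Type*) [TopologicalSpace X] [PartialOrder X]
    [EsakiaSpace X] :
    IsForcing (· ≤ ·) fun (x : X) (U : ClopenUpperSet X) => x ∈ U where
  top _ := trivial
  bot _ h := h
  inf _ _ _ := Iff.rfl
  sup _ _ _ := Iff.rfl
  himp x U V := by
    constructor
    · intro h y hxy hU
      by_contra hV
      exact h ⟨y, ⟨hU, hV⟩, hxy⟩
    · rintro h ⟨y, ⟨hU, hV⟩, hxy⟩
      exact hV (h y hxy hU)

/-! ### Equations for width and incomparability degree -/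

/-- A term that is refuted at `x` exactly when there is an antichain of three elements above
`x`. -/
def widthTerm : HTerm :=
  .sup (.imp (.var 0) (.sup (.var 1) (.var 2)))
    (.sup (.imp (.var 1) (.sup (.var 0) (.var 2))) (.imp (.var 2) (.sup (.var 0) (.var 1))))

/-- A term that is refuted at `x` exactly when a point above `x` is incomparable with the members
of a chain of three elements above `x`. -/
def chainTerm : HTerm :=
  .sup (.imp (.var 0) (.var 1))
    (.imp (.var 1) (.sup (.var 2)
      (.imp (.var 2) (.sup (.var 3) (.imp (.var 3) (.var 0))))))

section Forcing

variable {P A : Type*} [HeytingAlgebra A] {R : P → P → Prop} {φ : P → A → Prop}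

theorem IsForcing.not_widthTerm (h : IsForcing R φ) (v : ℕ → A) (x : P) :
    ¬ φ x (widthTerm.eval v) ↔
      (∃ y, R x y ∧ φ y (v 0) ∧ ¬ φ y (v 1) ∧ ¬ φ y (v 2)) ∧
      (∃ y, R x y ∧ φ y (v 1) ∧ ¬ φ y (v 0) ∧ ¬ φ y (v 2)) ∧
      ∃ y, R x y ∧ φ y (v 2) ∧ ¬ φ y (v 0) ∧ ¬ φ y (v 1) := by
  simp only [widthTerm, HTerm.eval, h.sup, h.himp]
  push Not
  rfl

theorem IsForcing.not_chainTerm (h : IsForcing R φ) (v : ℕ → A) (x : P) :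
    ¬ φ x (chainTerm.eval v) ↔
      (∃ y, R x y ∧ φ y (v 0) ∧ ¬ φ y (v 1)) ∧
      ∃ z₁, R x z₁ ∧ φ z₁ (v 1) ∧ ¬ φ z₁ (v 2) ∧
      ∃ z₂, R z₁ z₂ ∧ φ z₂ (v 2) ∧ ¬ φ z₂ (v 3) ∧
      ∃ z₃, R z₂ z₃ ∧ φ z₃ (v 3) ∧ ¬ φ z₃ (v 0) := by
  simp only [chainTerm, HTerm.eval, h.sup, h.himp]
  push Not
  rfl

end Forcing

section Order

variable {P : Type u} [PartialOrder P]

theorem widthAtMost_two_iff : WidthAtMost 2 P ↔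
    ∀ x y₀ y₁ y₂ : P, x ≤ y₀ → x ≤ y₁ → x ≤ y₂ → ¬ y₀ ≤ y₁ → ¬ y₀ ≤ y₂ → ¬ y₁ ≤ y₀ → ¬ y₁ ≤ y₂ →
      ¬ y₂ ≤ y₀ → ¬ y₂ ≤ y₁ → False := by
  classical
  constructor
  · intro h x y₀ y₁ y₂ h0 h1 h2 h01 h02 h10 h12 h20 h21
    refine h x ⟨{y₀, y₁, y₂}, Finset.card_eq_three.2 ⟨y₀, y₁, y₂, ?_, ?_, ?_, rfl⟩, ?_, ?_⟩
    · exact fun h => h01 h.le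
    · exact fun h => h02 h.le
    · exact fun h => h12 h.le
    · intro z hz
      simp only [Finset.coe_insert, Finset.coe_singleton, Set.mem_insert_iff,
        Set.mem_singleton_iff] at hz
      rcases hz with rfl | rfl | rfl <;> assumption
    · intro a ha b hb hab
      simp only [Finset.coe_insert, Finset.coe_singleton, Set.mem_insert_iff,
        Set.mem_singleton_iff] at ha hb
      rcases ha with rfl | rfl | rfl <;> rcases hb with rfl | rfl | rfl <;>
        first | assumption | exact absurd rfl hab
  · rintro h x ⟨S, hS, hx, hanti⟩
    obtain ⟨a, b, c, hab, hac, hbc, rfl⟩ := Finset.card_eq_three.1 hS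
    have ha : a ∈ (({a, b, c} : Finset P) : Set P) := by simp
    have hb : b ∈ (({a, b, c} : Finset P) : Set P) := by simp
    have hc : c ∈ (({a, b, c} : Finset P) : Set P) := by simp
    exact h x a b c (hx ha) (hx hb) (hx hc) (hanti ha hb hab) (hanti ha hc hac)
      (hanti hb ha hab.symm) (hanti hb hc hbc) (hanti hc ha hac.symm) (hanti hc hb hbc.symm)

theorem incomparabilityDegreeAtMost_two_iff : IncomparabilityDegreeAtMost 2 P ↔
    ∀ x y z₀ z₁ z₂ : P, x ≤ y → x ≤ z₀ → x ≤ z₁ → x ≤ z₂ → z₀ ≠ z₁ → z₀ ≠ z₂ → z₁ ≠ z₂ →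
      ¬ y ≤ z₀ → ¬ z₀ ≤ y → ¬ y ≤ z₁ → ¬ z₁ ≤ y → ¬ y ≤ z₂ → ¬ z₂ ≤ y → False := by
  classical
  constructor
  · intro h x y z₀ z₁ z₂ hy h0 h1 h2 h01 h02 h12 a a' b b' c c'
    refine h x y hy ⟨{z₀, z₁, z₂}, Finset.card_eq_three.2 ⟨z₀, z₁, z₂, h01, h02, h12, rfl⟩, ?_, ?_⟩
    · intro z hz
      simp only [Finset.coe_insert, Finset.coe_singleton, Set.mem_insert_iff,
        Set.mem_singleton_iff] at hz
      rcases hz with rfl | rfl | rfl <;> assumption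
    · intro z hz
      simp only [Finset.mem_insert, Finset.mem_singleton] at hz
      rcases hz with rfl | rfl | rfl <;> constructor <;> assumption
  · rintro h x y hy ⟨S, hS, hx, hinc⟩
    obtain ⟨a, b, c, hab, hac, hbc, rfl⟩ := Finset.card_eq_three.1 hS
    have ha : a ∈ ({a, b, c} : Finset P) := by simp
    have hb : b ∈ ({a, b, c} : Finset P) := by simp
    have hc : c ∈ ({a, b, c} : Finset P) := by simp
    exact h x y a b c hy (hx ha) (hx hb) (hx hc) hab hac hbc (hinc a ha).1 (hinc a ha).2
      (hinc b hb).1 (hinc b hb).2 (hinc c hc).1 (hinc c hc).2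

/-- For posets of width at most two, incomparability degree at most two only has to be tested
on chains. -/
theorem incomparabilityDegreeAtMost_two_iff_chain (hw : WidthAtMost 2 P) :
    IncomparabilityDegreeAtMost 2 P ↔
    ∀ x y z₀ z₁ z₂ : P, x ≤ y → x ≤ z₀ → z₀ < z₁ → z₁ < z₂ → ¬ y ≤ z₂ → ¬ z₀ ≤ y → False := by
  rw [incomparabilityDegreeAtMost_two_iff]
  constructor
  · intro h x y z₀ z₁ z₂ hy h0 h01 h12 h2 h0'
    exact h x y z₀ z₁ z₂ hy h0 (h0.trans h01.le) (h0.trans (h01.trans h12).le) h01.ne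
      (h01.trans h12).ne h12.ne (fun h => h2 (h.trans (h01.trans h12).le)) h0'
      (fun h => h2 (h.trans h12.le)) (fun h => h0' (h01.le.trans h)) h2
      (fun h => h0' ((h01.trans h12).le.trans h))
  · intro h x y z₀ z₁ z₂ hy h0 h1 h2 h01 h02 h12 a a' b b' c c'
    have hcomp : ∀ z z' : P, x ≤ z → x ≤ z' → z ≠ z' → ¬ y ≤ z → ¬ z ≤ y → ¬ y ≤ z' → ¬ z' ≤ y →
        z < z' ∨ z' < z := by
      intro z z' hz hz' hne p q r s
      by_contra! hlt
      exact widthAtMost_two_iff.1 hw x y z z' hy hz hz' p r q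
        (fun hle => hlt.1 (lt_of_le_of_ne hle hne)) s
        (fun hle => hlt.2 (lt_of_le_of_ne hle hne.symm))
    rcases hcomp z₀ z₁ h0 h1 h01 a a' b b' with p | p <;>
      rcases hcomp z₀ z₂ h0 h2 h02 a a' c c' with q | q <;>
      rcases hcomp z₁ z₂ h1 h2 h12 b b' c c' with r | r
    · exact h x y z₀ z₁ z₂ hy h0 p r c a'
    · exact h x y z₀ z₂ z₁ hy h0 q r b a'
    · exact lt_irrefl _ (p.trans (r.trans q))
    · exact h x y z₂ z₀ z₁ hy h2 q p b c'
    · exact h x y z₁ z₀ z₂ hy h1 p q c b'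
    · exact lt_irrefl _ (q.trans (r.trans p))
    · exact h x y z₁ z₂ z₀ hy h1 r q a b'
    · exact h x y z₂ z₁ z₀ hy h2 r p a c'

end Order

theorem satisfies_top_iff {A : Type u} [HeytingAlgebra A] (t : HTerm) :
    Satisfies A (t, .top) ↔ ∀ (v : ℕ → A) (w : DualSpace A), t.eval v ∈ w.1 := by
  refine forall_congr' fun v => ⟨fun h w => ?_, fun h => eq_of_forall_mem_iff fun w => ?_⟩
  · change t.eval v = ⊤ at h
    rw [h]
    exact (isPrimePred_mem w).top
  · exact iff_of_true (h w) (isPrimePred_mem w).top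

theorem satisfies_widthTerm_iff {A : Type u} [HeytingAlgebra A] :
    Satisfies A (widthTerm, .top) ↔ WidthAtMost 2 (DualSpace A) := by
  rw [satisfies_top_iff, widthAtMost_two_iff]
  constructor
  · intro h x y₀ y₁ y₂ h0 h1 h2 h01 h02 h10 h12 h20 h21
    obtain ⟨a01, p01, q01⟩ := DualSpace.not_le_iff.1 h01
    obtain ⟨a02, p02, q02⟩ := DualSpace.not_le_iff.1 h02
    obtain ⟨a10, p10, q10⟩ := DualSpace.not_le_iff.1 h10
    obtain ⟨a12, p12, q12⟩ := DualSpace.not_le_iff.1 h12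
    obtain ⟨a20, p20, q20⟩ := DualSpace.not_le_iff.1 h20
    obtain ⟨a21, p21, q21⟩ := DualSpace.not_le_iff.1 h21
    refine (isForcing_dualSpace.not_widthTerm
      (fun n => if n = 0 then a01 ⊓ a02 else if n = 1 then a10 ⊓ a12 else a20 ⊓ a21) x).2 ?_ (h _ x)
    exact ⟨⟨y₀, h0, by simp [*]⟩, ⟨y₁, h1, by simp [*]⟩, ⟨y₂, h2, by simp [*]⟩⟩
  · intro h v x
    by_contra hx
    obtain ⟨⟨y₀, h0, p0, p1, p2⟩, ⟨y₁, h1, q1, q0, q2⟩, ⟨y₂, h2, r2, r0, r1⟩⟩ :=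
      (isForcing_dualSpace.not_widthTerm v x).1 hx
    exact h x y₀ y₁ y₂ h0 h1 h2 (fun hle => q0 (hle p0)) (fun hle => r0 (hle p0))
      (fun hle => p1 (hle q1)) (fun hle => r1 (hle q1)) (fun hle => p2 (hle r2))
      (fun hle => q2 (hle r2))

theorem satisfies_chainTerm_iff {A : Type u} [HeytingAlgebra A]
    (hw : WidthAtMost 2 (DualSpace A)) :
    Satisfies A (chainTerm, .top) ↔ IncomparabilityDegreeAtMost 2 (DualSpace A) := by
  rw [satisfies_top_iff, incomparabilityDegreeAtMost_two_iff_chain hw]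
  constructor
  · intro h x y z₀ z₁ z₂ hy h0 h01 h12 h2 h0'
    obtain ⟨a, pa, qa⟩ := DualSpace.not_le_iff.1 h2
    obtain ⟨b, pb, qb⟩ := DualSpace.not_le_iff.1 h0'
    obtain ⟨c, pc, qc⟩ := DualSpace.not_le_iff.1 h01.not_ge
    obtain ⟨d, pd, qd⟩ := DualSpace.not_le_iff.1 h12.not_ge
    exact (isForcing_dualSpace.not_chainTerm
      (fun n => if n = 0 then a else if n = 1 then b else if n = 2 then c else d) x).2
      ⟨⟨y, hy, pa, qb⟩, z₀, h0, pb, qc, z₁, h01.le, pc, qd, z₂, h12.le, pd, qa⟩ (h _ x)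
  · intro h v x
    by_contra hx
    obtain ⟨⟨y, hy, p0, p1⟩, z₁, h1, q1, q2, z₂, h2, r2, r3, z₃, h3, s3, s0⟩ :=
      (isForcing_dualSpace.not_chainTerm v x).1 hx
    refine h x y z₁ z₂ z₃ hy h1 (lt_of_le_of_ne h2 ?_) (lt_of_le_of_ne h3 ?_)
      (fun hle => s0 (hle p0)) (fun hle => p1 (hle q1))
    · rintro rfl
      exact q2 r2
    · rintro rfl
      exact r3 s3

theorem classID2W2_iff (A : Type u) [HeytingAlgebra A] :
    ClassID2W2 A ↔ Satisfies A (widthTerm, .top) ∧ Satisfies A (chainTerm, .top) := by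
  constructor
  · exact fun h => ⟨satisfies_widthTerm_iff.2 h.2, (satisfies_chainTerm_iff h.2).2 h.1⟩
  · intro h
    have hw := satisfies_widthTerm_iff.1 h.1
    exact ⟨(satisfies_chainTerm_iff hw).1 h.2, hw⟩

theorem isVariety_classID2W2 : IsVariety ClassID2W2.{u} :=
  ⟨{(widthTerm, .top), (chainTerm, .top)}, fun A _ => by simp [classID2W2_iff]⟩

/-! ### The Rieger–Nishimura lattice -/

theorem RNLadder.le_iff {x y : RNLadder} : x ≤ y ↔ x.index = y.index ∨ x.index + 2 ≤ y.index := by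
  obtain ⟨i⟩ := x
  obtain ⟨j⟩ := y
  exact or_congr_left ⟨fun h => congrArg RNLadder.index h, fun h => congrArg RNLadder.mk h⟩

theorem satisfies_riegerNishimura_top {t : HTerm}
    (h : ∀ (v : ℕ → RiegerNishimura) (x : RNLadder), x ∈ t.eval v) :
    Satisfies RiegerNishimura (t, .top) :=
  fun v => LowerSet.ext (Set.eq_univ_of_forall (h v))

theorem generatedVariety_riegerNishimura_subclass :
    IsSubclass (GeneratedVariety.{u} RiegerNishimura) ClassID2W2 := by
  intro A _ hA
  refine (classID2W2_iff A).2 ⟨hA _ (satisfies_riegerNishimura_top fun v x => ?_),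
    hA _ (satisfies_riegerNishimura_top fun v x => ?_)⟩
  · by_contra hx
    obtain ⟨⟨y₀, h0, p0, p1, p2⟩, ⟨y₁, h1, q1, q0, q2⟩, ⟨y₂, h2, r2, r0, r1⟩⟩ :=
      ((isForcing_lowerSet RNLadder).not_widthTerm v x).1 hx
    have h01 : ¬ y₀ ≤ y₁ := fun h => p1 ((v 1).lower h q1)
    have h02 : ¬ y₀ ≤ y₂ := fun h => p2 ((v 2).lower h r2)
    have h10 : ¬ y₁ ≤ y₀ := fun h => q0 ((v 0).lower h p0)
    have h12 : ¬ y₁ ≤ y₂ := fun h => q2 ((v 2).lower h r2)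
    have h20 : ¬ y₂ ≤ y₀ := fun h => r0 ((v 0).lower h p0)
    have h21 : ¬ y₂ ≤ y₁ := fun h => r1 ((v 1).lower h q1)
    rw [RNLadder.le_iff] at h01 h02 h10 h12 h20 h21
    omega
  · by_contra hx
    obtain ⟨⟨y, hy, p0, p1⟩, z₁, h1, q1, q2, z₂, h2, r2, r3, z₃, h3, s3, s0⟩ :=
      ((isForcing_lowerSet RNLadder).not_chainTerm v x).1 hx
    have a : ¬ z₂ ≤ z₃ := fun h => r3 ((v 3).lower h s3)
    have b : ¬ z₁ ≤ z₂ := fun h => q2 ((v 2).lower h r2)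
    have c : ¬ y ≤ z₁ := fun h => p1 ((v 1).lower h q1)
    have d : ¬ z₃ ≤ y := fun h => s0 ((v 0).lower h p0)
    rw [RNLadder.le_iff] at a b c d h2 h3
    omega

/-! ### Narrow orders on the natural numbers -/

/-- A transitive relation on the natural numbers that is contained in `<` and relates all pairs
of numbers at distance at least two. -/
class IsNarrow (r : ℕ → ℕ → Prop) : Prop where
  trans : ∀ i j k, r i j → r j k → r i k
  lt : ∀ i j, r i j → i < j
  of_add_two_le : ∀ i j, i + 2 ≤ j → r i j

/-- The natural numbers, ordered by the converse of `r`. -/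
structure SeqPoint (r : ℕ → ℕ → Prop) : Type u where
  index : ℕ

instance (r : ℕ → ℕ → Prop) [IsNarrow r] : PartialOrder (SeqPoint.{u} r) where
  le x y := y.index = x.index ∨ r y.index x.index
  le_refl _ := Or.inl rfl
  le_trans x y z := by
    rintro (h | h) (h' | h')
    · exact Or.inl (h'.trans h)
    · exact Or.inr (h ▸ h')
    · exact Or.inr (h' ▸ h)
    · exact Or.inr (IsNarrow.trans _ _ _ h' h)
  le_antisymm x y := by
    obtain ⟨i⟩ := x
    obtain ⟨j⟩ := y
    rintro (h | h) (h' | h')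
    · exact congrArg _ h'
    · exact congrArg _ h.symm
    · exact congrArg _ h'
    · exact absurd (IsNarrow.lt _ _ h) (IsNarrow.lt _ _ h').asymm

/-- The algebra of all subsets of the natural numbers that are closed upwards under `r`. -/
abbrev SeqAlgebra (r : ℕ → ℕ → Prop) [IsNarrow r] : Type u := LowerSet (SeqPoint.{u} r)

/-- The order on the natural numbers generated by `r`, with a new greatest element `none`. -/
def ExtLe (r : ℕ → ℕ → Prop) : Option ℕ → Option ℕ → Prop
  | _, none => True
  | none, some _ => False
  | some i, some j => i = j ∨ r i j

/-- Membership in an element of `SeqAlgebra r`; the point `none` belongs to all nonempty sets. -/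
def ExtMem {r : ℕ → ℕ → Prop} [IsNarrow r] : Option ℕ → SeqAlgebra.{u} r → Prop
  | none, U => ∃ i, (⟨i⟩ : SeqPoint r) ∈ U
  | some i, U => (⟨i⟩ : SeqPoint r) ∈ U

section Narrow

variable {r : ℕ → ℕ → Prop} [IsNarrow r]

theorem SeqAlgebra.mem_of_rel {U : SeqAlgebra.{u} r} {i j : ℕ} (hi : (⟨i⟩ : SeqPoint r) ∈ U)
    (h : i = j ∨ r i j) : (⟨j⟩ : SeqPoint r) ∈ U :=
  U.lower (show (⟨j⟩ : SeqPoint r) ≤ ⟨i⟩ from h) hi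

/-- The principal upset generated by `i`. -/
def upFrom (r : ℕ → ℕ → Prop) [IsNarrow r] (i : ℕ) : SeqAlgebra.{u} r :=
  LowerSet.Iic ⟨i⟩

theorem mem_upFrom {i j : ℕ} : (⟨j⟩ : SeqPoint.{u} r) ∈ upFrom r i ↔ i = j ∨ r i j := Iff.rfl

theorem extMem_upFrom {i : ℕ} {e : Option ℕ} :
    ExtMem e (upFrom.{u} r i) ↔ ExtLe r (some i) e := by
  cases e with
  | none => exact iff_of_true ⟨i, Or.inl rfl⟩ trivial
  | some j => exact Iff.rfl

theorem ExtMem.mono {U : SeqAlgebra.{u} r} {e e' : Option ℕ} (h : ExtLe r e e')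
    (he : ExtMem e U) : ExtMem e' U := by
  cases e with
  | none =>
    cases e' with
    | none => exact he
    | some j => exact h.elim
  | some i =>
    cases e' with
    | none => exact ⟨i, he⟩
    | some j => exact SeqAlgebra.mem_of_rel he h

/-- The forcing relation of `SeqAlgebra r` on the natural numbers with a new greatest element. -/
theorem isForcing_extMem : IsForcing (ExtLe r) (ExtMem (r := r)) where
  top e := by
    cases e with
    | none => exact ⟨0, trivial⟩
    | some i => trivial
  bot e h := by
    cases e with
    | none => exact h.elim fun _ h => h
    | some i => exact h
  inf e U V := by
    cases e with
    | none =>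
      constructor
      · rintro ⟨i, hU, hV⟩
        exact ⟨⟨i, hU⟩, ⟨i, hV⟩⟩
      · rintro ⟨⟨i, hi⟩, ⟨j, hj⟩⟩
        exact ⟨i + j + 2,
          SeqAlgebra.mem_of_rel hi (Or.inr (IsNarrow.of_add_two_le _ _ (by omega))),
          SeqAlgebra.mem_of_rel hj (Or.inr (IsNarrow.of_add_two_le _ _ (by omega)))⟩
    | some i => exact Iff.rfl
  sup e U V := by
    cases e with
    | none => exact exists_or
    | some i => exact Iff.rfl
  himp e U V := by
    have key := (isForcing_lowerSet (SeqPoint r)).himp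
    cases e with
    | none =>
      constructor
      · rintro ⟨i, hi⟩ e' he' hU
        cases e' with
        | some j => exact he'.elim
        | none =>
          obtain ⟨j, hj⟩ := hU
          refine ⟨i + j + 2, (key _ U V).1 hi _
            (Or.inr (IsNarrow.of_add_two_le _ _ (by change i + 2 ≤ i + j + 2; omega))) ?_⟩
          exact SeqAlgebra.mem_of_rel hj (Or.inr (IsNarrow.of_add_two_le _ _ (by omega)))
      · intro h
        by_cases hU : ∃ i, (⟨i⟩ : SeqPoint r) ∈ U
        · obtain ⟨j, hj⟩ := h none trivial hU
          have hle : V ≤ U ⇨ V := le_himp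
          exact ⟨j, hle hj⟩
        · exact ⟨0, (key _ U V).2 fun q _ hq => absurd ⟨q.index, hq⟩ hU⟩
    | some i =>
      refine (key _ U V).trans ⟨fun h e' he' hU => ?_, fun h q hq hU => h (some q.index) hq hU⟩
      cases e' with
      | some j => exact h ⟨j⟩ he' hU
      | none =>
        obtain ⟨j, hj⟩ := hU
        refine ⟨i + j + 2, h ⟨i + j + 2⟩
          (Or.inr (IsNarrow.of_add_two_le _ _ (by change i + 2 ≤ i + j + 2; omega))) ?_⟩
        exact SeqAlgebra.mem_of_rel hj (Or.inr (IsNarrow.of_add_two_le _ _ (by omega)))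

theorem SeqAlgebra.ext_some {U V : SeqAlgebra.{u} r}
    (h : ∀ i, ExtMem (some i) U ↔ ExtMem (some i) V) : U = V :=
  LowerSet.ext (Set.ext fun x => h x.index)

theorem extLe_of_forall_extMem {e e' : Option ℕ}
    (h : ∀ U : SeqAlgebra.{u} r, ExtMem e U → ExtMem e' U) : ExtLe r e e' := by
  cases e with
  | some i => exact extMem_upFrom.1 (h (upFrom r i) (Or.inl rfl))
  | none =>
    cases e' with
    | none => trivial
    | some j =>
      rcases mem_upFrom.1 (h (upFrom r (j + 1)) ⟨j + 1, Or.inl rfl⟩) with h' | h'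
      · omega
      · exact absurd (IsNarrow.lt _ _ h') (by omega)

theorem ExtLe.antisymm {e e' : Option ℕ} (h : ExtLe r e e') (h' : ExtLe r e' e) : e = e' := by
  cases e <;> cases e'
  · rfl
  · exact h.elim
  · exact h'.elim
  · rcases h with h | h
    · rw [h]
    · rcases h' with h' | h'
      · rw [h']
      · exact absurd (IsNarrow.lt _ _ h) (IsNarrow.lt _ _ h').asymm

/-- Every prime filter of `SeqAlgebra r` is given by a point. -/
theorem exists_extMem_iff {T : SeqAlgebra.{u} r → Prop} (hT : IsPrimePred T) :
    ∃ e, ∀ U, T U ↔ ExtMem e U := by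
  classical
  by_cases hall : ∀ i, T (upFrom r i)
  · refine ⟨none, fun U => ⟨fun h => ?_, ?_⟩⟩
    · by_contra hU
      have : U = ⊥ := SeqAlgebra.ext_some fun i => iff_of_false (fun h => hU ⟨i, h⟩) fun h => h
      exact hT.bot (this ▸ h)
    · rintro ⟨i, hi⟩
      exact hT.mono (LowerSet.Iic_le.2 hi) (hall i)
  · push Not at hall
    obtain ⟨n, hn⟩ := hall
    have cover : ∀ U : SeqAlgebra.{u} r, T U →
        ∃ i, (⟨i⟩ : SeqPoint r) ∈ U ∧ i < n + 2 ∧ T (upFrom r i) := by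
      intro U hU
      have hle : U ≤ upFrom r n ⊔ ((Finset.range (n + 2)).filter
          fun i => (⟨i⟩ : SeqPoint.{u} r) ∈ U).sup (fun i => upFrom r i) := by
        rintro ⟨j⟩ hj
        by_cases hjn : j < n + 2
        · have h1 : upFrom.{u} r j ≤ ((Finset.range (n + 2)).filter
              fun i => (⟨i⟩ : SeqPoint.{u} r) ∈ U).sup (fun i => upFrom r i) :=
            Finset.le_sup (f := fun i => upFrom.{u} r i) (by simpa using ⟨hjn, hj⟩)
          exact Or.inr (h1 (mem_upFrom.2 (Or.inl rfl)))
        · exact Or.inl (mem_upFrom.2 (Or.inr (IsNarrow.of_add_two_le _ _ (by omega))))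
      rcases (hT.sup _ _).1 (hT.mono hle hU) with h | h
      · exact absurd h hn
      · obtain ⟨i, hi, hTi⟩ := hT.finset_sup _ _ h
        simp only [Finset.mem_filter, Finset.mem_range] at hi
        exact ⟨i, hi.2, hi.1, hTi⟩
    have hbdd : ∃ m, ∀ i, T (upFrom r i) → i ≤ m := by
      refine ⟨n + 1, fun i hi => ?_⟩
      by_contra hlt
      exact hn (hT.mono (LowerSet.Iic_le.2
        (mem_upFrom.2 (Or.inr (IsNarrow.of_add_two_le _ _ (by omega))))) hi)
    obtain ⟨m, hm⟩ := hbdd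
    obtain ⟨i₀, -, -, hi₀⟩ := cover ⊤ hT.top
    have hmax := Nat.findGreatest_spec (P := fun i => T (upFrom.{u} r i)) (hm i₀ hi₀) hi₀
    have hle : ∀ i, T (upFrom r i) → i ≤ Nat.findGreatest (fun i => T (upFrom.{u} r i)) m :=
      fun i hi => Nat.le_findGreatest (hm i hi) hi
    set k := Nat.findGreatest (fun i => T (upFrom.{u} r i)) m
    refine ⟨some k, fun U => ⟨fun h => ?_, fun h => hT.mono (LowerSet.Iic_le.2 h) hmax⟩⟩
    obtain ⟨i, hi, -, hTi⟩ := cover (U ⊓ upFrom r k) ((hT.inf _ _).2 ⟨h, hmax⟩)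
    rcases mem_upFrom.1 hi.2 with rfl | hr
    · exact hi.1
    · exact absurd (IsNarrow.lt _ _ hr) (hle i hTi).not_gt

end Narrow

/-- Two p-morphisms with the same composite with `f` from a poset to the order generated by `r`
with a greatest element. -/
structure IsFiberedPair (r : ℕ → ℕ → Prop) (f : ℕ → ℕ) {W : Type*} [Preorder W]
    (G H : W → Option ℕ) : Prop where
  mono_left : ∀ w w', w ≤ w' → ExtLe r (G w) (G w')
  mono_right : ∀ w w', w ≤ w' → ExtLe r (H w) (H w')
  back_left : ∀ w e, ExtLe r (G w) e → ∃ w', w ≤ w' ∧ G w' = e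
  back_right : ∀ w e, ExtLe r (H w) e → ∃ w', w ≤ w' ∧ H w' = e
  map_eq : ∀ w, (G w).map f = (H w).map f

theorem IsFiberedPair.symm {r : ℕ → ℕ → Prop} {f : ℕ → ℕ} {W : Type*} [Preorder W]
    {G H : W → Option ℕ} (h : IsFiberedPair r f G H) : IsFiberedPair r f H G :=
  ⟨h.mono_right, h.mono_left, h.back_right, h.back_left, fun w => (h.map_eq w).symm⟩

/-! ### Homomorphisms given by p-morphisms -/

section PMorphism

variable {r s : ℕ → ℕ → Prop} [IsNarrow r] [IsNarrow s]

/-- `f` is a p-morphism between the orders generated by `r` and `s`. -/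
structure IsPMorphism (r s : ℕ → ℕ → Prop) (f : ℕ → ℕ) : Prop where
  mono : ∀ i j, r i j → f i = f j ∨ s (f i) (f j)
  back : ∀ i k, s (f i) k → ∃ j, r i j ∧ f j = k

/-- The homomorphism dual to a p-morphism. -/
def IsPMorphism.hom {f : ℕ → ℕ} (hf : IsPMorphism r s f) :
    HeytingHom (SeqAlgebra.{u} s) (SeqAlgebra.{u} r) where
  toFun U := ⟨{x | (⟨f x.index⟩ : SeqPoint s) ∈ U}, by
    rintro x y (h | h) hx
    · change (⟨f y.index⟩ : SeqPoint s) ∈ U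
      rw [← h]
      exact hx
    · exact SeqAlgebra.mem_of_rel hx (hf.mono _ _ h)⟩
  map_sup' _ _ := rfl
  map_inf' _ _ := rfl
  map_bot' := rfl
  map_himp' U V := by
    refine SeqAlgebra.ext_some fun i => Iff.trans ?_ ((isForcing_lowerSet _).himp _ _ _).symm
    refine ((isForcing_lowerSet _).himp (⟨f i⟩ : SeqPoint s) U V).trans ?_
    constructor
    · rintro h ⟨j⟩ (hj | hj) hU
      · exact h _ (Or.inl (congrArg f hj)) hU
      · exact h _ (hf.mono _ _ hj) hU
    · rintro h ⟨k⟩ (hk | hk) hU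
      · have hk' : f i = k := hk
        subst hk'
        exact h ⟨i⟩ le_rfl hU
      · obtain ⟨j, hij, rfl⟩ := hf.back _ _ hk
        exact h ⟨j⟩ (Or.inr hij) hU

theorem IsPMorphism.mem_hom {f : ℕ → ℕ} (hf : IsPMorphism r s f) (U : SeqAlgebra.{u} s) (i : ℕ) :
    (⟨i⟩ : SeqPoint r) ∈ hf.hom U ↔ (⟨f i⟩ : SeqPoint s) ∈ U := Iff.rfl

theorem IsPMorphism.hom_injective {f : ℕ → ℕ} (hf : IsPMorphism r s f)
    (hsurj : Function.Surjective f) : Function.Injective (IsPMorphism.hom.{u} hf) := by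
  intro U V h
  refine SeqAlgebra.ext_some fun k => ?_
  obtain ⟨i, rfl⟩ := hsurj k
  change (⟨i⟩ : SeqPoint r) ∈ hf.hom U ↔ (⟨i⟩ : SeqPoint r) ∈ hf.hom V
  rw [h]

theorem IsPMorphism.not_surjective_hom {f : ℕ → ℕ} (hf : IsPMorphism r s f) {i j : ℕ}
    (hij : i < j) (h : f i = f j) : ¬ Function.Surjective (IsPMorphism.hom.{u} hf) := by
  intro hsurj
  obtain ⟨U, hU⟩ := hsurj (upFrom r j)
  have hj : (⟨j⟩ : SeqPoint r) ∈ hf.hom U := hU ▸ mem_upFrom.2 (Or.inl rfl)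
  have hi : (⟨i⟩ : SeqPoint r) ∈ hf.hom U := by
    rw [hf.mem_hom, h]
    exact hj
  rw [hU, mem_upFrom] at hi
  rcases hi with hi | hi
  · omega
  · exact absurd (IsNarrow.lt _ _ hi) hij.asymm

theorem IsPMorphism.extMem_hom {f : ℕ → ℕ} (hf : IsPMorphism r s f)
    (hsurj : Function.Surjective f) (U : SeqAlgebra.{u} s) (e : Option ℕ) :
    ExtMem e (hf.hom U) ↔ ExtMem (e.map f) U := by
  cases e with
  | some i => exact Iff.rfl
  | none =>
    constructor
    · rintro ⟨i, hi⟩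
      exact ⟨f i, hi⟩
    · rintro ⟨k, hk⟩
      obtain ⟨i, rfl⟩ := hsurj k
      exact ⟨i, hk⟩

/-- A homomorphism defined on `SeqAlgebra r` is dual to a p-morphism. -/
theorem exists_dual_pMorphism {C : Type v} [HeytingAlgebra C]
    (g : HeytingHom (SeqAlgebra.{u} r) C) : ∃ G : DualSpace C → Option ℕ,
      (∀ w U, g U ∈ w.1 ↔ ExtMem (G w) U) ∧
      (∀ w w', w ≤ w' → ExtLe r (G w) (G w')) ∧
      ∀ w e, ExtLe r (G w) e → ∃ w', w ≤ w' ∧ G w' = e := by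
  have hpt : ∀ w : DualSpace C, ∃ e, ∀ U, g U ∈ w.1 ↔ ExtMem e U := fun w =>
    exists_extMem_iff
      { top := by
          rw [map_top]
          exact (isPrimePred_mem w).top
        bot := by
          rw [map_bot]
          exact (isPrimePred_mem w).bot
        inf := fun a b => by
          rw [map_inf]
          exact (isPrimePred_mem w).inf _ _
        sup := fun a b => by
          rw [map_sup]
          exact (isPrimePred_mem w).sup _ _ }
  choose G hG using hpt
  refine ⟨G, hG, fun w w' hw => ?_, fun w e he => ?_⟩
  · exact extLe_of_forall_extMem fun U hU => (hG w' U).1 (hw ((hG w U).2 hU))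
  · obtain ⟨w', h1, h2⟩ := exists_le_dualSpace_comap g w (isForcing_extMem.isPrimePred e)
      (fun U hU => ((hG w U).1 hU).mono he)
    exact ⟨w', h1, ExtLe.antisymm
      (extLe_of_forall_extMem fun U hU => (h2 U).1 ((hG w' U).2 hU))
      (extLe_of_forall_extMem fun U hU => (hG w' U).1 ((h2 U).2 hU))⟩

/-- Homomorphisms that agree on the image of `hf.hom` are dual to a fibered pair. -/
theorem IsPMorphism.exists_isFiberedPair {f : ℕ → ℕ} (hf : IsPMorphism r s f)
    (hsurj : Function.Surjective f) {C : Type u} [HeytingAlgebra C]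
    (g h : HeytingHom (SeqAlgebra.{u} r) C) (hgh : g.comp hf.hom = h.comp hf.hom) :
    ∃ G H : DualSpace C → Option ℕ, IsFiberedPair r f G H ∧
      (∀ w U, g U ∈ w.1 ↔ ExtMem (G w) U) ∧ ∀ w U, h U ∈ w.1 ↔ ExtMem (H w) U := by
  obtain ⟨G, hG, hG1, hG2⟩ := exists_dual_pMorphism g
  obtain ⟨H, hH, hH1, hH2⟩ := exists_dual_pMorphism h
  refine ⟨G, H, ⟨hG1, hH1, hG2, hH2, fun w => ?_⟩, hG, hH⟩
  have key : ∀ U : SeqAlgebra.{u} s, ExtMem ((G w).map f) U ↔ ExtMem ((H w).map f) U := by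
    intro U
    rw [← hf.extMem_hom hsurj, ← hf.extMem_hom hsurj, ← hG, ← hH,
      show g (hf.hom U) = h (hf.hom U) from DFunLike.congr_fun hgh U]
  exact ExtLe.antisymm (extLe_of_forall_extMem fun U => (key U).1)
    (extLe_of_forall_extMem fun U => (key U).2)

end PMorphism

/-- The order of a sequence of two-element antichains `{2 k, 2 k + 1}`. -/
def PairRel (i j : ℕ) : Prop := i / 2 < j / 2

/-- The order of the ascending ladder. -/
def LadderRel (i j : ℕ) : Prop := i + 2 ≤ j

/-- The order of the ascending chain. -/
def ChainRel (i j : ℕ) : Prop := i < j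

instance : IsNarrow PairRel where
  trans _ _ _ := lt_trans
  lt _ _ h := by
    unfold PairRel at h
    omega
  of_add_two_le _ _ h := by
    unfold PairRel
    omega

instance : IsNarrow LadderRel where
  trans _ _ _ h h' := by
    unfold LadderRel at *
    omega
  lt _ _ h := by
    unfold LadderRel at h
    omega
  of_add_two_le _ _ h := h

instance : IsNarrow ChainRel where
  trans _ _ _ := lt_trans
  lt _ _ h := h
  of_add_two_le _ _ h := by
    unfold ChainRel
    omega

section Fibered

variable {r : ℕ → ℕ → Prop} {f : ℕ → ℕ} {W : Type*} [Preorder W] {G H : W → Option ℕ}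

theorem IsFiberedPair.exists_right (h : IsFiberedPair r f G H) {w : W} {i : ℕ}
    (hG : G w = some i) : ∃ j, H w = some j ∧ f j = f i := by
  have := h.map_eq w
  rw [hG, Option.map_some, eq_comm, Option.map_eq_some_iff] at this
  exact this

theorem IsFiberedPair.right_eq_none (h : IsFiberedPair r f G H) {w : W} (hG : G w = none) :
    H w = none := by
  have := h.map_eq w
  rwa [hG, Option.map_none, eq_comm, Option.map_eq_none_iff] at this

theorem IsFiberedPair.rel_left (h : IsFiberedPair r f G H) {w w' : W} {i j : ℕ} (hw : w ≤ w')
    (hG : G w = some i) (hG' : G w' = some j) : i = j ∨ r i j := by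
  have := h.mono_left w w' hw
  rwa [hG, hG'] at this

theorem IsFiberedPair.rel_right (h : IsFiberedPair r f G H) {w w' : W} {i j : ℕ} (hw : w ≤ w')
    (hH : H w = some i) (hH' : H w' = some j) : i = j ∨ r i j :=
  h.symm.rel_left hw hH hH'

/-- The back property on the left, with both values at the new point. -/
theorem IsFiberedPair.exists_of_left (h : IsFiberedPair r f G H) {w : W} {i i' j : ℕ}
    (hG : G w = some i) (hH : H w = some i') (hij : i = j ∨ r i j) :
    ∃ w' j', w ≤ w' ∧ G w' = some j ∧ H w' = some j' ∧ f j' = f j ∧ (i' = j' ∨ r i' j') := by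
  obtain ⟨w', hw, hj⟩ := h.back_left w (some j) (by rw [hG]; exact hij)
  obtain ⟨j', hj', hf⟩ := h.exists_right hj
  exact ⟨w', j', hw, hj, hj', hf, h.rel_right hw hH hj'⟩

theorem IsFiberedPair.exists_of_right (h : IsFiberedPair r f G H) {w : W} {i i' j' : ℕ}
    (hG : G w = some i) (hH : H w = some i') (hij : i' = j' ∨ r i' j') :
    ∃ w' j, w ≤ w' ∧ G w' = some j ∧ H w' = some j' ∧ f j = f j' ∧ (i = j ∨ r i j) := by
  obtain ⟨w', j, hw, h1, h2, h3⟩ := h.symm.exists_of_left hH hG hij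
  exact ⟨w', j, hw, h2, h1, h3⟩

end Fibered

/-! ### The ladder -/

theorem isPMorphism_ladder : IsPMorphism LadderRel ChainRel fun i => i / 2 where
  mono i j h := by
    unfold LadderRel at h
    unfold ChainRel
    omega
  back i k h := by
    unfold ChainRel at h
    unfold LadderRel
    refine ⟨2 * k + 1, ?_, ?_⟩ <;> omega

theorem IsFiberedPair.ladder_false {W : Type u} [PartialOrder W]
    (hW : IncomparabilityDegreeAtMost 2 W) {G H : W → Option ℕ}
    (h : IsFiberedPair LadderRel (fun i => i / 2) G H) {w : W} {k : ℕ} (hG : G w = some (2 * k))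
    (hH : H w = some (2 * k + 1)) : False := by
  obtain ⟨a, i, hwa, ha, ha', hi, hi'⟩ := h.exists_of_left (j := 2 * k + 2) hG hH (Or.inr le_rfl)
  have e : i = 2 * k + 3 := by unfold LadderRel at hi'; omega
  subst e
  obtain ⟨a₁, i, haa, ha₁, ha₁', hi, hi'⟩ :=
    h.exists_of_left (j := 2 * k + 4) ha ha' (Or.inr le_rfl)
  have e : i = 2 * k + 5 := by unfold LadderRel at hi'; omega
  subst e
  obtain ⟨b, i, hwb, hb, hb', hi, hi'⟩ :=
    h.exists_of_left (j := 2 * k + 3) hG hH (Or.inr (by unfold LadderRel; omega))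
  have e : i = 2 * k + 3 := by unfold LadderRel at hi'; omega
  subst e
  obtain ⟨c, i, hwc, hc, hc', -, -⟩ :=
    h.exists_of_right (j' := 2 * k + 4) hG hH (Or.inr (by unfold LadderRel; omega))
  refine incomparabilityDegreeAtMost_two_iff.1 hW w b a a₁ c hwb hwa (hwa.trans haa) hwc
    ?_ ?_ ?_ ?_ ?_ ?_ ?_ ?_ ?_
  · rintro rfl
    simp [ha] at ha₁
  · rintro rfl
    simp [ha'] at hc'
  · rintro rfl
    simp [ha₁'] at hc'
  · exact fun hle => by have := h.rel_left hle hb ha; unfold LadderRel at this; omega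
  · exact fun hle => by have := h.rel_left hle ha hb; unfold LadderRel at this; omega
  · exact fun hle => by have := h.rel_left hle hb ha₁; unfold LadderRel at this; omega
  · exact fun hle => by have := h.rel_left hle ha₁ hb; unfold LadderRel at this; omega
  · exact fun hle => by have := h.rel_right hle hb' hc'; unfold LadderRel at this; omega
  · exact fun hle => by have := h.rel_right hle hc' hb'; unfold LadderRel at this; omega

theorem IsFiberedPair.eq_of_ladder {W : Type u} [PartialOrder W]
    (hW : IncomparabilityDegreeAtMost 2 W) {G H : W → Option ℕ}
    (h : IsFiberedPair LadderRel (fun i => i / 2) G H) : G = H := by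
  funext w
  cases hG : G w with
  | none => exact (h.right_eq_none hG).symm
  | some i =>
    obtain ⟨j, hj, hij⟩ := h.exists_right hG
    rw [hj]
    rcases (by omega : i = j ∨ (i = 2 * (i / 2) ∧ j = 2 * (i / 2) + 1) ∨
      (j = 2 * (i / 2) ∧ i = 2 * (i / 2) + 1)) with e | ⟨e, e'⟩ | ⟨e, e'⟩
    · rw [e]
    · rw [e] at hG
      rw [e'] at hj
      exact (h.ladder_false hW hG hj).elim
    · rw [e'] at hG
      rw [e] at hj
      exact (h.symm.ladder_false hW hj hG).elim

/-- No class of Heyting algebras of incomparability degree at most two that is a variety and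
contains the ladder algebra has surjective epimorphisms. -/
theorem not_hasES_of_ladder {K : HAClass.{u}} (hK : IsVariety K) (hID : IsSubclass K (ClassID 2))
    (hL : K (SeqAlgebra.{u} LadderRel)) : ¬ HasES K := by
  intro hES
  have hsurj : Function.Surjective fun i : ℕ => i / 2 := fun k => ⟨2 * k, by dsimp only; omega⟩
  have hC : K (SeqAlgebra.{u} ChainRel) := hK.of_satisfies hL
    fun _ => Satisfies.of_injective (isPMorphism_ladder.hom_injective hsurj)
  refine isPMorphism_ladder.not_surjective_hom (i := 0) (j := 1) one_pos rfl
    (hES _ _ hC hL isPMorphism_ladder.hom ?_)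
  intro C _ hCK g h hgh
  obtain ⟨G, H, hGH, hG, hH⟩ := isPMorphism_ladder.exists_isFiberedPair hsurj g h hgh
  refine DFunLike.ext _ _ fun U => eq_of_forall_mem_iff fun w => ?_
  rw [hG, hH, hGH.eq_of_ladder (hID C hCK)]

/-! ### The sequence of two-element antichains -/

theorem isPMorphism_pair : IsPMorphism PairRel ChainRel fun i => (i + 1) / 2 where
  mono i j h := by
    unfold PairRel at h
    unfold ChainRel
    omega
  back i k h := by
    unfold ChainRel at h
    unfold PairRel
    refine ⟨2 * k, ?_, ?_⟩ <;> omega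

/-- The left coordinate of the `i`-th rung of the ladder in the product of two sequences of
antichains. -/
def rungLeft (n i : ℕ) : ℕ :=
  2 * (n + i / 3) + if i % 3 = 0 then 2 else if i % 3 = 1 then 4 else 5

/-- The right coordinate of the `i`-th rung of the ladder. -/
def rungRight (n i : ℕ) : ℕ :=
  2 * (n + i / 3) + if i % 3 = 0 then 2 else if i % 3 = 1 then 3 else 5

theorem rung_le_iff (n i j : ℕ) :
    ((rungLeft n i = rungLeft n j ∨ PairRel (rungLeft n i) (rungLeft n j)) ∧
      (rungRight n i = rungRight n j ∨ PairRel (rungRight n i) (rungRight n j))) ↔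
    (i = j ∨ LadderRel i j) := by
  unfold rungLeft rungRight PairRel LadderRel
  have := Nat.mod_lt i (by norm_num : 3 > 0)
  have := Nat.mod_lt j (by norm_num : 3 > 0)
  split_ifs <;> omega

section Rungs

variable {W : Type u} [PartialOrder W] {G H : W → Option ℕ} {w₀ : W} {n : ℕ}

theorem rung_three_mul (n m : ℕ) :
    rungLeft n (3 * m) = 2 * (n + m) + 2 ∧ rungRight n (3 * m) = 2 * (n + m) + 2 := by
  unfold rungLeft rungRight
  constructor <;> split_ifs <;> omega

theorem rung_three_mul_add_one (n m : ℕ) :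
    rungLeft n (3 * m + 1) = 2 * (n + m) + 4 ∧ rungRight n (3 * m + 1) = 2 * (n + m) + 3 := by
  unfold rungLeft rungRight
  constructor <;> split_ifs <;> omega

theorem rung_three_mul_add_two (n m : ℕ) :
    rungLeft n (3 * m + 2) = 2 * (n + m) + 5 ∧ rungRight n (3 * m + 2) = 2 * (n + m) + 5 := by
  unfold rungLeft rungRight
  constructor <;> split_ifs <;> omega

theorem IsFiberedPair.exists_even_odd (h : IsFiberedPair PairRel (fun i => (i + 1) / 2) G H)
    (hG : G w₀ = some (2 * n + 2)) (hH : H w₀ = some (2 * n + 1)) (m : ℕ) :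
    ∃ w, w₀ ≤ w ∧ G w = some (2 * (n + m) + 2) ∧ H w = some (2 * (n + m) + 1) := by
  induction m with
  | zero => exact ⟨w₀, le_rfl, hG, hH⟩
  | succ m ih =>
    obtain ⟨w, hw, h1, h2⟩ := ih
    obtain ⟨w', i, hww, h3, h4, hi, hi'⟩ := h.exists_of_right (j' := 2 * (n + (m + 1)) + 1) h1 h2
      (Or.inr (by unfold PairRel; omega))
    have e : i = 2 * (n + (m + 1)) + 2 := by unfold PairRel at hi'; omega
    exact ⟨w', hw.trans hww, e ▸ h3, h4⟩

theorem IsFiberedPair.exists_even_even (h : IsFiberedPair PairRel (fun i => (i + 1) / 2) G H)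
    (hG : G w₀ = some (2 * n + 2)) (hH : H w₀ = some (2 * n + 1)) (m : ℕ) :
    ∃ w, w₀ ≤ w ∧ G w = some (2 * (n + m) + 2) ∧ H w = some (2 * (n + m) + 2) := by
  obtain ⟨w, hw, h1, h2⟩ := h.exists_even_odd hG hH m
  obtain ⟨w', i, hww, h3, h4, hi, hi'⟩ := h.exists_of_right (j' := 2 * (n + m) + 2) h1 h2
    (Or.inr (by unfold PairRel; omega))
  have e : i = 2 * (n + m) + 2 := by unfold PairRel at hi'; omega
  exact ⟨w', hw.trans hww, e ▸ h3, h4⟩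

theorem IsFiberedPair.odd_even_false (hW : IncomparabilityDegreeAtMost 2 W)
    (h : IsFiberedPair PairRel (fun i => (i + 1) / 2) G H) (hG : G w₀ = some (2 * n + 2))
    (hH : H w₀ = some (2 * n + 1)) {w : W} (hw : w₀ ≤ w) {m : ℕ}
    (h1 : G w = some (2 * (n + m) + 5)) (h2 : H w = some (2 * (n + m) + 6)) : False := by
  obtain ⟨z, hz, hz1, hz2⟩ := h.exists_even_odd hG hH (m + 2)
  obtain ⟨p, hp, hp1, hp2⟩ := h.exists_even_even hG hH (m + 1)
  obtain ⟨q, -, hq, hq1, -⟩ := h.exists_of_left (j := 2 * (n + m) + 7) hG hH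
    (Or.inr (by unfold PairRel; omega))
  refine incomparabilityDegreeAtMost_two_iff.1 hW w₀ z w p q hz hw hp hq ?_ ?_ ?_ ?_ ?_ ?_ ?_ ?_ ?_
  · rintro rfl
    rw [h1, Option.some_inj] at hp1
    omega
  · rintro rfl
    rw [h1, Option.some_inj] at hq1
    omega
  · rintro rfl
    rw [hp1, Option.some_inj] at hq1
    omega
  · exact fun hle => by have := h.rel_left hle hz1 h1; unfold PairRel at this; omega
  · exact fun hle => by have := h.rel_right hle h2 hz2; unfold PairRel at this; omega
  · exact fun hle => by have := h.rel_left hle hz1 hp1; unfold PairRel at this; omega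
  · exact fun hle => by have := h.rel_right hle hp2 hz2; unfold PairRel at this; omega
  · exact fun hle => by have := h.rel_left hle hz1 hq1; unfold PairRel at this; omega
  · exact fun hle => by have := h.rel_left hle hq1 hz1; unfold PairRel at this; omega

theorem IsFiberedPair.exists_rung (hW : IncomparabilityDegreeAtMost 2 W)
    (h : IsFiberedPair PairRel (fun i => (i + 1) / 2) G H) (hG : G w₀ = some (2 * n + 2))
    (hH : H w₀ = some (2 * n + 1)) (i : ℕ) :
    ∃ w, w₀ ≤ w ∧ G w = some (rungLeft n i) ∧ H w = some (rungRight n i) := by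
  rcases (by omega : i = 3 * (i / 3) ∨ i = 3 * (i / 3) + 1 ∨ i = 3 * (i / 3) + 2) with e | e | e
  · rw [e, (rung_three_mul n _).1, (rung_three_mul n _).2]
    exact h.exists_even_even hG hH _
  · rw [e, (rung_three_mul_add_one n _).1, (rung_three_mul_add_one n _).2]
    exact h.exists_even_odd hG hH (i / 3 + 1)
  · rw [e, (rung_three_mul_add_two n _).1, (rung_three_mul_add_two n _).2]
    obtain ⟨w, j, hw, h1, h2, hj, -⟩ := h.exists_of_left (j := 2 * (n + i / 3) + 5) hG hH
      (Or.inr (by unfold PairRel; omega))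
    rcases (by omega : j = 2 * (n + i / 3) + 5 ∨ j = 2 * (n + i / 3) + 6) with rfl | rfl
    · exact ⟨w, hw, h1, h2⟩
    · exact (h.odd_even_false hW hG hH hw h1 h2).elim

/-- The possible values of a fibered pair above a point at which it takes distinct values. -/
theorem IsFiberedPair.rung_cases (hW : IncomparabilityDegreeAtMost 2 W)
    (h : IsFiberedPair PairRel (fun i => (i + 1) / 2) G H) (hG : G w₀ = some (2 * n + 2))
    (hH : H w₀ = some (2 * n + 1)) {w : W} (hw : w₀ ≤ w) {a b : ℕ} (ha : G w = some a)
    (hb : H w = some b) :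
    (a = 2 * n + 2 ∧ b = 2 * n + 1) ∨ ∃ i, a = rungLeft n i ∧ b = rungRight n i := by
  have h1 := h.rel_left hw hG ha
  have h2 := h.rel_right hw hH hb
  obtain ⟨b', hb', hab⟩ := h.exists_right ha
  rw [hb, Option.some_inj] at hb'
  subst hb'
  unfold PairRel at h1 h2
  have hcases : (a = 2 * n + 2 ∧ b = 2 * n + 1) ∨
      (∃ m, a = 2 * (n + m) + 2 ∧ b = 2 * (n + m) + 2) ∨
      (∃ m, a = 2 * (n + m) + 4 ∧ b = 2 * (n + m) + 3) ∨
      (∃ m, a = 2 * (n + m) + 5 ∧ b = 2 * (n + m) + 5) ∨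
      (∃ m, a = 2 * (n + m) + 5 ∧ b = 2 * (n + m) + 6) := by
    by_cases h3 : a % 2 = 0 <;> by_cases h4 : b = a
    · exact Or.inr (Or.inl ⟨a / 2 - n - 1, by omega⟩)
    · by_cases h5 : a = 2 * n + 2
      · exact Or.inl (by omega)
      · exact Or.inr (Or.inr (Or.inl ⟨a / 2 - n - 2, by omega⟩))
    · exact Or.inr (Or.inr (Or.inr (Or.inl ⟨a / 2 - n - 2, by omega⟩)))
    · exact Or.inr (Or.inr (Or.inr (Or.inr ⟨a / 2 - n - 2, by omega⟩)))
  rcases hcases with e | ⟨m, e, e'⟩ | ⟨m, e, e'⟩ | ⟨m, e, e'⟩ | ⟨m, e, e'⟩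
  · exact Or.inl e
  · exact Or.inr ⟨3 * m, by rw [(rung_three_mul n _).1, (rung_three_mul n _).2, e, e']; simp⟩
  · exact Or.inr ⟨3 * m + 1, by
      rw [(rung_three_mul_add_one n _).1, (rung_three_mul_add_one n _).2, e, e']; simp⟩
  · exact Or.inr ⟨3 * m + 2, by
      rw [(rung_three_mul_add_two n _).1, (rung_three_mul_add_two n _).2, e, e']; simp⟩
  · exact (h.odd_even_false hW hG hH hw (e ▸ ha) (e' ▸ hb)).elim

theorem IsFiberedPair.rung_rel (h : IsFiberedPair PairRel (fun i => (i + 1) / 2) G H) {w w' : W}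
    (hw : w ≤ w') {i j : ℕ} (h1 : G w = some (rungLeft n i)) (h2 : H w = some (rungRight n i))
    (h1' : G w' = some (rungLeft n j)) (h2' : H w' = some (rungRight n j)) :
    i = j ∨ LadderRel i j :=
  (rung_le_iff n i j).1 ⟨h.rel_left hw h1 h1', h.rel_right hw h2 h2'⟩

theorem IsFiberedPair.rung_le (hW : IncomparabilityDegreeAtMost 2 W)
    (h : IsFiberedPair PairRel (fun i => (i + 1) / 2) G H) (hG : G w₀ = some (2 * n + 2))
    (hH : H w₀ = some (2 * n + 1)) {w w' : W} (hw : w₀ ≤ w) (hw' : w₀ ≤ w') {i j : ℕ}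
    (h1 : G w = some (rungLeft n i)) (h2 : H w = some (rungRight n i))
    (h1' : G w' = some (rungLeft n j)) (h2' : H w' = some (rungRight n j))
    (hij : LadderRel i j) : w ≤ w' := by
  unfold LadderRel at hij
  by_contra hle
  obtain ⟨a, ha, ha1, ha2⟩ := h.exists_rung hW hG hH (j - 1)
  obtain ⟨b, hb, hb1, hb2⟩ := h.exists_rung hW hG hH (j + 1)
  refine incomparabilityDegreeAtMost_two_iff.1 hW w₀ w' w a b hw' hw ha hb ?_ ?_ ?_ ?_ hle
    ?_ ?_ ?_ ?_
  · rintro rfl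
    have := h.rung_rel le_rfl ha1 ha2 h1 h2
    unfold LadderRel at this
    omega
  · rintro rfl
    have := h.rung_rel le_rfl hb1 hb2 h1 h2
    unfold LadderRel at this
    omega
  · rintro rfl
    have := h.rung_rel le_rfl hb1 hb2 ha1 ha2
    unfold LadderRel at this
    omega
  all_goals intro hle'
  · have := h.rung_rel hle' h1' h2' h1 h2
    unfold LadderRel at this
    omega
  · have := h.rung_rel hle' h1' h2' ha1 ha2
    unfold LadderRel at this
    omega
  · have := h.rung_rel hle' ha1 ha2 h1' h2'
    unfold LadderRel at this
    omega
  · have := h.rung_rel hle' h1' h2' hb1 hb2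
    unfold LadderRel at this
    omega
  · have := h.rung_rel hle' hb1 hb2 h1' h2'
    unfold LadderRel at this
    omega

end Rungs

/-- Every upset of the ladder is generated by at most two points. -/
theorem ladder_eq_bot_or (U : SeqAlgebra.{u} LadderRel) : U = ⊥ ∨ ∃ i,
    U = upFrom LadderRel i ∨ U = upFrom LadderRel i ⊔ upFrom LadderRel (i + 1) := by
  classical
  by_cases hU : ∃ i, (⟨i⟩ : SeqPoint LadderRel) ∈ U
  · right
    have hi := Nat.find_spec hU
    have hmin : ∀ j, (⟨j⟩ : SeqPoint LadderRel) ∈ U → Nat.find hU ≤ j :=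
      fun j hj => Nat.find_min' hU hj
    set i := Nat.find hU
    refine ⟨i, ?_⟩
    by_cases hi' : (⟨i + 1⟩ : SeqPoint LadderRel) ∈ U
    · right
      refine SeqAlgebra.ext_some fun j => ⟨fun hj => ?_, fun hj => ?_⟩
      · have := hmin j hj
        rcases (by omega : i = j ∨ i + 1 = j ∨ i + 2 ≤ j) with e | e | e
        · exact Or.inl (Or.inl e)
        · exact Or.inr (Or.inl e)
        · exact Or.inl (Or.inr e)
      · exact hj.elim (SeqAlgebra.mem_of_rel hi) (SeqAlgebra.mem_of_rel hi')
    · left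
      refine SeqAlgebra.ext_some fun j => ⟨fun hj => ?_, SeqAlgebra.mem_of_rel hi⟩
      have := hmin j hj
      rcases (by omega : i = j ∨ j = i + 1 ∨ i + 2 ≤ j) with e | e | e
      · exact Or.inl e
      · exact absurd (e ▸ hj) hi'
      · exact Or.inr e
  · left
    exact SeqAlgebra.ext_some fun i => iff_of_false (fun h => hU ⟨i, h⟩) fun h => h

/-- If two homomorphisms from the algebra of the sequence of antichains to an algebra `C` of
incomparability degree at most two agree on the chain but are dual to maps that differ at a
point, then the ladder algebra satisfies the equations of `C`. -/
theorem satisfies_ladder {C : Type u} [HeytingAlgebra C] (hC : ClassID 2 C)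
    (g h : HeytingHom (SeqAlgebra.{u} PairRel) C) {G H : DualSpace C → Option ℕ}
    (hGH : IsFiberedPair PairRel (fun i => (i + 1) / 2) G H)
    (hg : ∀ w U, g U ∈ w.1 ↔ ExtMem (G w) U) (hh : ∀ w U, h U ∈ w.1 ↔ ExtMem (H w) U)
    {w₀ : DualSpace C} {n : ℕ} (hG : G w₀ = some (2 * n + 2)) (hH : H w₀ = some (2 * n + 1))
    (e : HTerm × HTerm) (he : Satisfies C e) : Satisfies (SeqAlgebra.{u} LadderRel) e := by
  let Z : Option ℕ → DualSpace C → Prop := fun p w =>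
    w₀ ≤ w ∧ G w = p.map (rungLeft n) ∧ H w = p.map (rungRight n)
  have hup : ∀ i p w, Z p w → (ExtMem p (upFrom.{u} LadderRel i) ↔
      g (upFrom PairRel (rungLeft n i)) ⊓ h (upFrom PairRel (rungRight n i)) ∈ w.1) := by
    rintro i p w ⟨-, h1, h2⟩
    rw [Order.PFilter.inf_mem_iff, hg, hh, h1, h2, extMem_upFrom, extMem_upFrom, extMem_upFrom]
    cases p with
    | none => simp [ExtLe]
    | some j => exact (rung_le_iff n i j).symm
  refine satisfies_of_bisimulation isForcing_extMem isForcing_dualSpace Z ?_ ?_ ?_ ?_ e he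
  · rintro p w p' ⟨hw, h1, h2⟩ hp
    cases p' with
    | none =>
      obtain ⟨w', hw', h3⟩ := hGH.back_left w none (by cases p <;> rw [h1] <;> trivial)
      exact ⟨w', hw', hw.trans hw', h3, hGH.right_eq_none h3⟩
    | some j =>
      cases p with
      | none => exact hp.elim
      | some i =>
        rcases hp with rfl | hp
        · exact ⟨w, le_rfl, hw, h1, h2⟩
        · obtain ⟨w', hw', h3, h4⟩ := hGH.exists_rung hC hG hH j
          exact ⟨w', hGH.rung_le hC hG hH hw hw' h1 h2 h3 h4 hp, hw', h3, h4⟩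
  · rintro p w w' ⟨hw, h1, h2⟩ hw'
    cases hGw : G w' with
    | none => exact ⟨none, by cases p <;> trivial, hw.trans hw', hGw, hGH.right_eq_none hGw⟩
    | some a =>
      obtain ⟨b, hb, -⟩ := hGH.exists_right hGw
      cases p with
      | none =>
        have := hGH.mono_left w w' hw'
        rw [h1, hGw] at this
        exact this.elim
      | some i =>
        rcases hGH.rung_cases hC hG hH (hw.trans hw') hGw hb with ⟨rfl, rfl⟩ | ⟨j, rfl, rfl⟩
        · have h3 := hGH.rel_left hw' h1 hGw
          have h4 := hGH.rel_right hw' h2 hb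
          unfold PairRel rungLeft at h3
          unfold PairRel rungRight at h4
          split_ifs at h3 h4 <;> omega
        · exact ⟨some j, hGH.rung_rel hw' h1 h2 hGw hb, hw.trans hw', hGw, hb⟩
  · intro U
    rcases ladder_eq_bot_or U with rfl | ⟨i, rfl | rfl⟩
    · exact ⟨⊥, fun p w _ => iff_of_false (isForcing_extMem.bot p) (isForcing_dualSpace.bot w)⟩
    · exact ⟨_, hup i⟩
    · refine ⟨(g (upFrom PairRel (rungLeft n i)) ⊓ h (upFrom PairRel (rungRight n i))) ⊔
        (g (upFrom PairRel (rungLeft n (i + 1))) ⊓ h (upFrom PairRel (rungRight n (i + 1)))),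
        fun p w hz => ?_⟩
      rw [isForcing_extMem.sup, hup i p w hz, hup (i + 1) p w hz]
      exact (isForcing_dualSpace.sup w _ _).symm
  · intro U V hUV
    refine SeqAlgebra.ext_some fun i => ?_
    obtain ⟨w, hw, h1, h2⟩ := hGH.exists_rung hC hG hH i
    exact hUV (some i) w ⟨hw, h1, h2⟩

/-- No variety of Heyting algebras of incomparability degree at most two that contains the algebra
of the sequence of two-element antichains has surjective epimorphisms. -/
theorem not_hasES_of_pair {K : HAClass.{u}} (hK : IsVariety K) (hID : IsSubclass K (ClassID 2))
    (hP : K (SeqAlgebra.{u} PairRel)) : ¬ HasES K := by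
  intro hES
  have hsurj : Function.Surjective fun i : ℕ => (i + 1) / 2 :=
    fun k => ⟨2 * k, by dsimp only; omega⟩
  have hC : K (SeqAlgebra.{u} ChainRel) := hK.of_satisfies hP
    fun _ => Satisfies.of_injective (isPMorphism_pair.hom_injective hsurj)
  refine isPMorphism_pair.not_surjective_hom (i := 1) (j := 2) one_lt_two rfl
    (hES _ _ hC hP isPMorphism_pair.hom ?_)
  intro C _ hCK g h hgh
  obtain ⟨G, H, hGH, hG, hH⟩ := isPMorphism_pair.exists_isFiberedPair hsurj g h hgh
  have hGH' : G = H := by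
    funext w
    cases hGw : G w with
    | none => exact (hGH.right_eq_none hGw).symm
    | some i =>
      obtain ⟨j, hj, hij⟩ := hGH.exists_right hGw
      rw [hj]
      by_contra hne
      rw [Option.some_inj] at hne
      refine not_hasES_of_ladder hK hID (hK.of_satisfies hCK ?_) hES
      rcases (by omega : (i = 2 * (i / 2 - 1) + 2 ∧ j = 2 * (i / 2 - 1) + 1) ∨
        (j = 2 * (j / 2 - 1) + 2 ∧ i = 2 * (j / 2 - 1) + 1)) with ⟨e, e'⟩ | ⟨e, e'⟩
      · rw [e] at hGw
        rw [e'] at hj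
        exact satisfies_ladder (hID C hCK) g h hGH hG hH hGw hj
      · rw [e] at hj
        rw [e'] at hGw
        exact satisfies_ladder (hID C hCK) h g hGH.symm hH hG hj hGw
  refine DFunLike.ext _ _ fun U => eq_of_forall_mem_iff fun w => ?_
  rw [hG, hH, hGH']

/-! ### The space `D₂^∞` -/

/-- The enumeration of the points of `D₂^∞`. -/
def D2Infinity.code : D2Infinity → Option ℕ
  | .top => none
  | .pt k .left => some (2 * k)
  | .pt k .right => some (2 * k + 1)

theorem D2Infinity.code_surjective : Function.Surjective D2Infinity.code := by
  rintro (_ | i)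
  · exact ⟨.top, rfl⟩
  · rcases (by omega : i = 2 * (i / 2) ∨ i = 2 * (i / 2) + 1) with h | h
    · exact ⟨.pt (i / 2) .left, congrArg some h.symm⟩
    · exact ⟨.pt (i / 2) .right, congrArg some h.symm⟩

theorem D2Infinity.le_iff (x y : D2Infinity) : x ≤ y ↔ ExtLe PairRel x.code y.code := by
  have hpt : ∀ (k l : ℕ) (a b : D2), (SpaceSum.pt k a : D2Infinity) ≤ .pt l b ↔
      (k = l ∧ a = b) ∨ k < l := by
    intro k l a b
    by_cases h : k = l
    · subst h
      rw [SpaceSum.pt_le_pt_same]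
      exact ⟨fun h => Or.inl ⟨rfl, h⟩, fun h => (h.resolve_right (lt_irrefl _)).2⟩
    · rw [SpaceSum.pt_le_pt_of_ne h]
      exact ⟨Or.inr, fun h' => h'.resolve_left fun h'' => h h''.1⟩
  rcases y with _ | ⟨l, b⟩
  · exact iff_of_true (SpaceSum.Le.le_top _) (by unfold ExtLe D2Infinity.code; trivial)
  · rcases x with _ | ⟨k, a⟩
    · refine iff_of_false SpaceSum.not_top_le_pt ?_
      cases b <;> exact id
    · rw [hpt]
      cases a <;> cases b <;> simp only [D2Infinity.code, ExtLe, PairRel] <;> simp <;> omega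

theorem D2Infinity.code_injective : Function.Injective D2Infinity.code := by
  intro x y h
  apply le_antisymm <;> rw [D2Infinity.le_iff, h] <;> cases y.code <;> simp [ExtLe]

/-- The clopen upset of `D₂^∞` given by an upset of the sequence of antichains. -/
def clopenOfPair (U : SeqAlgebra.{u} PairRel) : ClopenUpperSet D2Infinity where
  carrier := {x | ExtMem x.code U}
  isClopen' := by
    refine ⟨⟨⟨fun _ => isOpen_discrete _, fun h => ⟨0, fun m _ x hx => h ?_⟩⟩⟩,
      ⟨fun _ => isOpen_discrete _, ?_⟩⟩
    · cases x <;> exact ⟨_, hx⟩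
    · rintro ⟨i, hi⟩
      refine ⟨i + 2, fun m hm x => ?_⟩
      cases x <;> exact SeqAlgebra.mem_of_rel hi (Or.inr (by unfold PairRel; omega))
  upper' x y hxy hx := hx.mono ((D2Infinity.le_iff x y).1 hxy)

theorem pair_mem_generatedVariety :
    GeneratedVariety.{u} (ClopenUpperSet D2Infinity) (SeqAlgebra.{u} PairRel) := by
  intro e
  refine satisfies_of_bisimulation isForcing_extMem (isForcing_clopenUpperSet D2Infinity)
    (fun p x => p = x.code) ?_ ?_ ?_ ?_ e
  · rintro _ x p' rfl hp
    obtain ⟨y, rfl⟩ := D2Infinity.code_surjective p'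
    exact ⟨y, (D2Infinity.le_iff x y).2 hp, rfl⟩
  · rintro _ x y rfl hxy
    exact ⟨_, (D2Infinity.le_iff x y).1 hxy, rfl⟩
  · intro U
    refine ⟨clopenOfPair U, ?_⟩
    rintro _ x rfl
    exact Iff.rfl
  · intro U V hUV
    refine SeqAlgebra.ext_some fun i => ?_
    obtain ⟨x, hx⟩ := D2Infinity.code_surjective (some i)
    exact hUV (some i) x hx.symm

/-! ### Clopen upsets of dual spaces -/

theorem isClopen_gammaSet {A : Type u} [HeytingAlgebra A] (a : A) : IsClopen (gammaSet a) :=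
  ⟨⟨TopologicalSpace.isOpen_generateFrom_of_mem (Or.inr ⟨a, rfl⟩)⟩,
    TopologicalSpace.isOpen_generateFrom_of_mem (Or.inl ⟨a, rfl⟩)⟩

theorem mem_finset_sup_iff {A : Type u} [HeytingAlgebra A] (w : DualSpace A) (s : Finset A) :
    s.sup id ∈ w.1 ↔ ∃ a ∈ s, a ∈ w.1 := by
  constructor
  · exact (isPrimePred_mem w).finset_sup s id
  · rintro ⟨a, ha, h⟩
    exact Order.PFilter.mem_of_le (Finset.le_sup (f := id) ha) h

theorem mem_finset_inf_iff {A : Type u} [HeytingAlgebra A] (w : DualSpace A) (s : Finset A) :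
    s.inf id ∈ w.1 ↔ ∀ a ∈ s, a ∈ w.1 := by
  classical
  induction s using Finset.induction_on with
  | empty => simp
  | insert b s _ ih =>
    rw [Finset.inf_insert, Order.PFilter.inf_mem_iff, ih]
    simp

/-- Clopen upsets of a compact dual space are represented by elements of the algebra. -/
theorem exists_gammaSet_eq {A : Type u} [HeytingAlgebra A] [CompactSpace (DualSpace A)]
    {U : Set (DualSpace A)} (hU : IsClopen U) (hup : IsUpperSet U) : ∃ a, gammaSet a = U := by
  have h1 : ∀ w ∈ U, ∃ a : A, w ∈ gammaSet a ∧ gammaSet a ⊆ U := by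
    intro w hw
    have hcov : Uᶜ ⊆ ⋃ a : {a : A // a ∈ w.1}, (gammaSet a.1)ᶜ := by
      intro w' hw'
      have hle : ¬ w ≤ w' := fun h => hw' (hup h hw)
      obtain ⟨a, ha, ha'⟩ := DualSpace.not_le_iff.1 hle
      exact Set.mem_iUnion.2 ⟨⟨a, ha⟩, ha'⟩
    obtain ⟨s, hs⟩ := hU.compl.isClosed.isCompact.elim_finite_subcover _
      (fun a : {a : A // a ∈ w.1} => (isClopen_gammaSet a.1).compl.isOpen) hcov
    classical
    refine ⟨(s.image Subtype.val).inf id, ?_, fun w' hw' => ?_⟩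
    · refine (mem_finset_inf_iff w _).2 fun a ha => ?_
      obtain ⟨b, -, rfl⟩ := Finset.mem_image.1 ha
      exact b.2
    · by_contra hw''
      obtain ⟨a, has, ha⟩ := Set.mem_iUnion₂.1 (hs hw'')
      exact ha ((mem_finset_inf_iff w' _).1 hw' a.1 (Finset.mem_image_of_mem _ has))
  have hcov : U ⊆ ⋃ a : {a : A // gammaSet a ⊆ U}, gammaSet a.1 := by
    intro w hw
    obtain ⟨a, ha, haU⟩ := h1 w hw
    exact Set.mem_iUnion.2 ⟨⟨a, haU⟩, ha⟩
  obtain ⟨s, hs⟩ := hU.isClosed.isCompact.elim_finite_subcover _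
    (fun a : {a : A // gammaSet a ⊆ U} => (isClopen_gammaSet a.1).isOpen) hcov
  classical
  refine ⟨(s.image Subtype.val).sup id, subset_antisymm (fun w hw => ?_) fun w hw => ?_⟩
  · obtain ⟨a, ha, haw⟩ := (mem_finset_sup_iff w _).1 hw
    obtain ⟨b, -, rfl⟩ := Finset.mem_image.1 ha
    exact b.2 haw
  · obtain ⟨a, has, ha⟩ := Set.mem_iUnion₂.1 (hs hw)
    exact (mem_finset_sup_iff w _).2 ⟨a.1, Finset.mem_image_of_mem _ has, ha⟩

/-- The algebra of clopen upsets of an Esakia space satisfies the equations of every algebra whose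
dual space is isomorphic to that space. -/
theorem satisfies_of_dualSpace_iso {X : Type v} [TopologicalSpace X] [PartialOrder X]
    [EsakiaSpace X] {A : Type u} [HeytingAlgebra A] (f : X ≃o DualSpace A) (hf : Continuous f)
    (hf' : Continuous f.symm) (e : HTerm × HTerm) (he : Satisfies A e) :
    Satisfies (ClopenUpperSet X) e := by
  have : CompactSpace X := EsakiaSpace.compactSpace
  have : CompactSpace (DualSpace A) := f.surjective.compactSpace hf
  refine satisfies_of_bisimulation (isForcing_clopenUpperSet X) isForcing_dualSpace
    (fun x w => f x = w) ?_ ?_ ?_ ?_ e he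
  · rintro x _ y rfl hxy
    exact ⟨f y, f.monotone hxy, rfl⟩
  · rintro x _ w rfl hw
    exact ⟨f.symm w, (f.le_symm_apply).2 hw, f.apply_symm_apply w⟩
  · intro U
    obtain ⟨a, ha⟩ := exists_gammaSet_eq (U := f.symm ⁻¹' U) (U.isClopen.preimage hf')
      fun w w' hw hU => U.upper (f.symm.monotone hw) hU
    refine ⟨a, ?_⟩
    rintro x _ rfl
    change x ∈ U ↔ f x ∈ gammaSet a
    rw [ha]
    change x ∈ U ↔ f.symm (f x) ∈ U
    rw [f.symm_apply_apply]
  · intro U V h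
    exact SetLike.ext fun x => h x (f x) rfl

theorem generatedVariety_subclass_of_inDualClass {K : HAClass.{u}} (hK : IsVariety K)
    {X : Type v} [TopologicalSpace X] [PartialOrder X] [EsakiaSpace X] (hX : InDualClass K X) :
    IsSubclass (GeneratedVariety (ClopenUpperSet X)) K := by
  obtain ⟨A, _, hA, f, hf, hf'⟩ := hX
  intro B _ hB
  exact hK.of_satisfies hA fun e he => hB e (satisfies_of_dualSpace_iso f hf hf' e he)

/-! ### The variety generated by the Rieger–Nishimura lattice contains `D₂^∞` -/

/-- A strict upper bound for the indices of the variables of a term. -/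
def HTerm.bound : HTerm → ℕ
  | .var n => n + 1
  | .bot => 0
  | .top => 0
  | .inf s t => max s.bound t.bound
  | .sup s t => max s.bound t.bound
  | .imp s t => max s.bound t.bound

theorem HTerm.eval_congr {A : Type u} [HeytingAlgebra A] {v w : ℕ → A} (t : HTerm)
    (h : ∀ n < t.bound, v n = w n) : t.eval v = t.eval w := by
  induction t with
  | var n => exact h n (Nat.lt_succ_self n)
  | bot => rfl
  | top => rfl
  | inf s t hs ht | sup s t hs ht | imp s t hs ht =>
    simp only [HTerm.eval, hs fun n hn => h n (lt_max_of_lt_left hn),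
      ht fun n hn => h n (lt_max_of_lt_right hn)]

theorem ClopenUpperSet.exists_stable (U : ClopenUpperSet D2Infinity) :
    ∃ N, ∀ x : D2Infinity, (∀ c, x.code = some c → 2 * N ≤ c) → (x ∈ U ↔ .top ∈ U) := by
  have key : ∀ V : Set D2Infinity, IsOpen V → .top ∈ V →
      ∃ N, ∀ x : D2Infinity, (∀ c, x.code = some c → 2 * N ≤ c) → x ∈ V := by
    intro V hV hT
    obtain ⟨N, hN⟩ := hV.2 hT
    refine ⟨N, fun x hx => ?_⟩
    rcases x with _ | ⟨k, a⟩
    · exact hT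
    · refine hN k ?_ a
      cases a
      · have := hx _ rfl
        omega
      · have := hx _ rfl
        omega
  by_cases hT : .top ∈ U
  · obtain ⟨N, hN⟩ := key U U.isClopen.isOpen hT
    exact ⟨N, fun x hx => iff_of_true (hN x hx) hT⟩
  · obtain ⟨N, hN⟩ := key (U : Set D2Infinity)ᶜ U.isClopen.compl.isOpen hT
    exact ⟨N, fun x hx => iff_of_false (hN x hx) hT⟩

/-- The graph of a p-morphism from an upset of the dual of the Rieger–Nishimura lattice onto
`D₂^∞` with all points of level at least `N` identified. -/
def LadderGraph (N : ℕ) (x : D2Infinity) (w : RNLadder) : Prop :=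
  (w.index ≤ 1 ∧ ∀ c, x.code = some c → 2 * N ≤ c) ∨
    (2 ≤ w.index ∧ ∃ c, x.code = some c ∧ c / 2 + (w.index - 2) / 3 + 1 = N ∧
      (c % 2 = 1 ↔ w.index % 3 = 0))

theorem LadderGraph.exists_right (N : ℕ) (x : D2Infinity) : ∃ w, LadderGraph N x w := by
  by_cases hx : ∀ c, x.code = some c → 2 * N ≤ c
  · exact ⟨⟨0⟩, Or.inl ⟨zero_le_one, hx⟩⟩
  · push Not at hx
    obtain ⟨c, hc, hcN⟩ := hx
    exact ⟨⟨3 * (N - 1 - c / 2) + 2 + c % 2⟩, Or.inr ⟨by dsimp only; omega, c, hc,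
      by dsimp only; omega, by dsimp only; omega⟩⟩

theorem LadderGraph.forth {N : ℕ} {x x' : D2Infinity} {w : RNLadder} (h : LadderGraph N x w)
    (hx : x ≤ x') : ∃ w', w' ≤ w ∧ LadderGraph N x' w' := by
  rw [D2Infinity.le_iff] at hx
  obtain ⟨w', hw'⟩ := LadderGraph.exists_right N x'
  rcases h with ⟨h1, h2⟩ | ⟨h1, c, hc, h2, h3⟩
  · refine ⟨w, le_rfl, Or.inl ⟨h1, fun c' hc' => ?_⟩⟩
    rw [hc'] at hx
    cases hxc : x.code with
    | none =>
      rw [hxc] at hx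
      exact hx.elim
    | some c =>
      rw [hxc] at hx
      have := h2 c hxc
      rcases hx with hx | hx
      · omega
      · unfold PairRel at hx
        omega
  · rw [hc] at hx
    by_cases hxe : x'.code = some c
    · exact ⟨w, le_rfl, Or.inr ⟨h1, c, hxe, h2, h3⟩⟩
    · by_cases hx' : ∀ c, x'.code = some c → 2 * N ≤ c
      · exact ⟨⟨0⟩, RNLadder.le_iff.2 (Or.inr h1), Or.inl ⟨zero_le_one, hx'⟩⟩
      · push Not at hx'
        obtain ⟨c', hc', hcN⟩ := hx'
        rw [hc'] at hx hxe
        rcases hx with rfl | hx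
        · exact absurd rfl hxe
        · unfold PairRel at hx
          refine ⟨⟨3 * (N - 1 - c' / 2) + 2 + c' % 2⟩, RNLadder.le_iff.2 (Or.inr ?_),
            Or.inr ⟨?_, c', hc', ?_, ?_⟩⟩ <;> dsimp only <;> omega

theorem LadderGraph.back {N : ℕ} {x : D2Infinity} {w w' : RNLadder} (h : LadderGraph N x w)
    (hw : w' ≤ w) : ∃ x', x ≤ x' ∧ LadderGraph N x' w' := by
  rw [RNLadder.le_iff] at hw
  rcases h with ⟨h1, h2⟩ | ⟨h1, c, hc, h2, h3⟩
  · exact ⟨x, le_rfl, Or.inl ⟨by omega, h2⟩⟩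
  · by_cases hw' : w'.index ≤ 1
    · refine ⟨.top, SpaceSum.Le.le_top _, Or.inl ⟨hw', fun c hc => ?_⟩⟩
      cases hc
    · by_cases he : (w'.index - 2) / 3 = (w.index - 2) / 3
      · exact ⟨x, le_rfl, Or.inr ⟨by omega, c, hc, by omega, by omega⟩⟩
      · obtain ⟨x', hx'⟩ := D2Infinity.code_surjective
          (some (2 * (N - 1 - (w'.index - 2) / 3) + if w'.index % 3 = 0 then 1 else 0))
        refine ⟨x', (D2Infinity.le_iff _ _).2 ?_, Or.inr ⟨by omega, _, hx', ?_, ?_⟩⟩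
        · rw [hc, hx']
          refine Or.inr ?_
          unfold PairRel
          split_ifs <;> omega
        · split_ifs <;> omega
        · split_ifs <;> omega

theorem LadderGraph.mem_iff {N : ℕ} {x y : D2Infinity} {w : RNLadder} (hx : LadderGraph N x w)
    (hy : LadderGraph N y w) {U : ClopenUpperSet D2Infinity}
    (hU : ∀ x : D2Infinity, (∀ c, x.code = some c → 2 * N ≤ c) → (x ∈ U ↔ .top ∈ U)) :
    x ∈ U ↔ y ∈ U := by
  rcases hx with ⟨h1, h2⟩ | ⟨h1, c, hc, h2, h3⟩ <;>
    rcases hy with ⟨h1', h2'⟩ | ⟨h1', c', hc', h2', h3'⟩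
  · rw [hU x h2, hU y h2']
  · omega
  · omega
  · have e : c = c' := by omega
    rw [D2Infinity.code_injective (hc.trans (e ▸ hc'.symm))]

theorem satisfies_of_riegerNishimura (e : HTerm × HTerm) (he : Satisfies RiegerNishimura e) :
    Satisfies (ClopenUpperSet D2Infinity) e := by
  intro v
  choose M hM using fun n => ClopenUpperSet.exists_stable (v n)
  set b := max e.1.bound e.2.bound
  set N := (Finset.range b).sup M
  let v' : ℕ → ClopenUpperSet D2Infinity := fun n => if n < b then v n else ⊥
  have hv' : ∀ n (x : D2Infinity), (∀ c, x.code = some c → 2 * N ≤ c) →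
      (x ∈ v' n ↔ .top ∈ v' n) := by
    intro n x hx
    by_cases hn : n < b
    · simp only [v', if_pos hn]
      refine hM n x fun c hc => ?_
      have h1 : M n ≤ N := Finset.le_sup (Finset.mem_range.2 hn)
      have h2 := hx c hc
      omega
    · simp only [v', if_neg hn]
      exact Iff.rfl
  let w : ℕ → RiegerNishimura := fun n => ⟨{y | ∃ x, LadderGraph N x y ∧ x ∈ v' n}, by
    rintro y y' hy ⟨x, hx, hxv⟩
    obtain ⟨x', hxx, hx'⟩ := hx.back hy
    exact ⟨x', hx', (v' n).upper hxx hxv⟩⟩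
  have key := (isForcing_clopenUpperSet D2Infinity).eval_iff (isForcing_lowerSet RNLadder)
    (LadderGraph N) (fun x y x' hxy hx => hxy.forth hx) (fun x y y' hxy hy => hxy.back hy)
    v' w (by
      intro n x y hxy
      refine ⟨fun hx => ⟨x, hxy, hx⟩, ?_⟩
      rintro ⟨x', hx', hxv⟩
      exact (hxy.mem_iff hx' (hv' n)).2 hxv)
  rw [e.1.eval_congr (w := v') fun n hn => (if_pos (lt_max_of_lt_left hn)).symm,
    e.2.eval_congr (w := v') fun n hn => (if_pos (lt_max_of_lt_right hn)).symm]
  refine SetLike.ext fun x => ?_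
  obtain ⟨y, hy⟩ := LadderGraph.exists_right N x
  rw [key e.1 x y hy, key e.2 x y hy, he]

theorem not_hasES_of_D2Infinity {K : HAClass.{u}} (hK : IsVariety K)
    (hD : IsSubclass (GeneratedVariety (ClopenUpperSet D2Infinity)) K)
    (hKW : IsSubclass K ClassID2W2) : ¬ HasES K :=
  not_hasES_of_pair hK (fun A _ hA => (hKW A hA).1) (hD _ pair_mem_generatedVariety)

end HeytingES

open HeytingES in
theorem corollary8p3 :
    (∀ K : HAClass.{u}, IsVariety K → IsSubclass K ClassID2W2 →
      InDualClass K D2Infinity → ¬ HasES K) ∧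
    IsVariety ClassID2W2.{u} ∧
    (∀ K : HAClass.{u}, IsVariety K →
      IsSubclass (GeneratedVariety (ClopenUpperSet D2Infinity)) K →
      IsSubclass K ClassID2W2 → ¬ HasES K) ∧
    IsSubclass (GeneratedVariety (ClopenUpperSet D2Infinity))
      (GeneratedVariety.{u} RiegerNishimura) ∧
    IsSubclass (GeneratedVariety.{u} RiegerNishimura) ClassID2W2 ∧
    ¬ HasES (GeneratedVariety.{u} RiegerNishimura) := by
  have hRN : IsSubclass (GeneratedVariety (ClopenUpperSet D2Infinity))
      (GeneratedVariety.{u} RiegerNishimura) :=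
    fun A _ hA e he => hA e (satisfies_of_riegerNishimura e he)
  exact ⟨fun K hK hKW hX =>
      not_hasES_of_D2Infinity hK (generatedVariety_subclass_of_inDualClass hK hX) hKW,
    isVariety_classID2W2, fun K hK hD hKW => not_hasES_of_D2Infinity hK hD hKW, hRN,
    generatedVariety_riegerNishimura_subclass,
    not_hasES_of_D2Infinity (generatedVariety_isVariety _) hRN
      generatedVariety_riegerNishimura_subclass⟩
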